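/- In \emph{capacity-constrained facility location} (CCFL) there are $m$ facilities; facility $i$ has a fixed charge $c_i\ge 0$ and a capacity $u_i>0$, known in advance, as is the number $n$ of clients. Clients $1,\dots,n$ arrive one at a time; on arrival, client $j$ reveals for each facility $i$ a demand $p_{ij}\ge 0$ and an assignment cost $a_{ij}\ge 0$. The algorithm may then open further facilities and must irrevocably assign the client to an open facility. The \emph{total cost} of a solution is its maximum congestion $\max_i \frac{1}{u_i}\sum_{j\to i}p_{ij}$, plus the fixed charges of the opened facilities, plus the assignment costs of the clients. Write $w_{ij}=c_i+p_{ij}/u_i+a_{ij}$, assume that all $w_{ij}>0$, and let $\rho=\max_j\frac{\max_i w_{ij}}{\min_i w_{ij}}$. Let $Z^*$ be the least total cost of an assignment of all the clients. \emph{Unrelated machine scheduling with start-up costs} (UMSC) is the case $u_i=1$, $a_{ij}=0$: facilities are machines, clients are jobs, $p_{ij}$ are processing times, and the total cost is the makespan plus the start-up costs of the machines used. \textbf{Theorem.} There is a universal constant $C$ such that for all $m,n\ge 2$ and all $(c_i)$, $(u_i)$ there is a randomized online algorithm for CCFL, which knows neither $\rho$ nor $Z^*$, with the following properties on every sequence of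 $n$ clients (fixed independently of the algorithm's random choices). The algorithm works in successive epochs with a parameter $Z$ that equals $2^k\min_i w_{i1}$ in epoch $k=0,1,2,\dots$ (an epoch may be empty); the epoch of each client is determined by the clients that have arrived so far. In each epoch the algorithm starts anew, that is, facilities have to be opened and paid for again, and a client $j$ that arrives in an epoch with parameter $Z$ is assigned to a facility $i$ with $w_{ij}\le Z$. The parameter $Z$ never exceeds $2Z^*$ when a client is served. The sum over all epochs of the expected total cost in each epoch is at most $$C\,\ln^2(mn)\,\ln(mn\rho)\,Z^*,$$ and hence so is the expected total cost of the solution obtained for all the clients. The same holds, with the same bound, for UMSC. -/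

import Mathlib

open MeasureTheory

/-- What a client reveals on arrival: for each of the `m` facilities, the cost of assigning the
client there and the demand that the client then places on the facility. -/
structure Client (m : ℕ) where
  assignCost : Fin m → ℝ
  demand : Fin m → ℝ

/-- A randomized online algorithm, run in epochs, for `n` requests of type `R` and `m` facilities.
The number `n` of requests is known to it in advance. Its random choices are the point `ω` of a
probability space; the request sequence `σ` is fixed independently of `ω`.

When request `j` arrives, the algorithm first decides (deterministically, from the requests seen
so far) the index `epoch σ j` of the current epoch; it then opens the set `newOpen ω σ j` of
facilities and irrevocably assigns the request to the facility `target ω σ j`. Every epoch starts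
afresh, so that a request can only be assigned to a facility opened in the current epoch. -/
structure EpochAlgorithm (R : Type) (m n : ℕ) where
  Ω : Type
  [measurableSpace : MeasurableSpace Ω]
  μ : Measure Ω
  [isProbabilityMeasure : IsProbabilityMeasure μ]
  epoch : (Fin n → R) → Fin n → ℕ
  newOpen : Ω → (Fin n → R) → Fin n → Finset (Fin m)
  target : Ω → (Fin n → R) → Fin n → Fin m
  /-- Decisions at request `j` depend on the requests up to `j` only. -/
  epoch_online : ∀ (σ τ : Fin n → R) (j : Fin n), (∀ k ≤ j, σ k = τ k) → epoch σ j = epoch τ j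
  newOpen_online : ∀ (ω : Ω) (σ τ : Fin n → R) (j : Fin n), (∀ k ≤ j, σ k = τ k) →
    newOpen ω σ j = newOpen ω τ j
  target_online : ∀ (ω : Ω) (σ τ : Fin n → R) (j : Fin n), (∀ k ≤ j, σ k = τ k) →
    target ω σ j = target ω τ j
  epoch_monotone : ∀ σ : Fin n → R, Monotone (epoch σ)
  target_open : ∀ (ω : Ω) (σ : Fin n → R) (j : Fin n),
    ∃ k ≤ j, epoch σ k = epoch σ j ∧ target ω σ j ∈ newOpen ω σ k
  measurableSet_newOpen : ∀ (σ : Fin n → R) (j : Fin n) (s : Finset (Fin m)),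
    MeasurableSet {ω | newOpen ω σ j = s}
  measurableSet_target : ∀ (σ : Fin n → R) (j : Fin n) (i : Fin m),
    MeasurableSet {ω | target ω σ j = i}

attribute [instance] EpochAlgorithm.measurableSpace EpochAlgorithm.isProbabilityMeasure

namespace EpochAlgorithm

variable {R : Type} {m n : ℕ} (A : EpochAlgorithm R m n)

/-- The epochs in which some request is served. -/
def epochs (σ : Fin n → R) : Finset ℕ :=
  Finset.univ.image (A.epoch σ)

/-- The requests served in epoch `k`. -/
def served (σ : Fin n → R) (k : ℕ) : Finset (Fin n) :=
  Finset.univ.filter fun j => A.epoch σ j = k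

/-- The facilities opened in epoch `k`. -/
def openedIn (ω : A.Ω) (σ : Fin n → R) (k : ℕ) : Finset (Fin m) :=
  (A.served σ k).biUnion (A.newOpen ω σ)

/-- The facilities opened in the whole run. -/
def opened (ω : A.Ω) (σ : Fin n → R) : Finset (Fin m) :=
  Finset.univ.biUnion (A.newOpen ω σ)

end EpochAlgorithm

/-- `ρ`, where `w j i` is the total cost of assigning request `j` alone to facility `i`. -/
noncomputable def costRatio {m n : ℕ} (w : Fin n → Fin m → ℝ) : ℝ :=
  ⨆ j, (⨆ i, w j i) / (⨅ i, w j i)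

/-- The value of `Z` in force when request `j` arrives: `Z` starts at the cheapest way to serve the
first request alone and is doubled from each epoch to the next. -/
noncomputable def EpochAlgorithm.currentZ {R : Type} {m n : ℕ} (A : EpochAlgorithm R m n)
    (w : Fin n → Fin m → ℝ) (σ : Fin n → R) (j : Fin n) : ℝ :=
  2 ^ A.epoch σ j * ⨅ i, w ⟨0, j.pos⟩ i

section CCFL

variable {m n : ℕ} (c u : Fin m → ℝ) (σ : Fin n → Client m)

/-- The total cost of client `j` if it is assigned alone to facility `i`. -/
noncomputable def ccflSingle (j : Fin n) (i : Fin m) : ℝ :=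
  c i + (σ j).demand i / u i + (σ j).assignCost i

/-- Total cost of serving the clients in `J` by the assignment `f` with open facilities `O`:
maximum congestion, fixed charges and assignment costs. -/
noncomputable def ccflCost (J : Finset (Fin n)) (O : Finset (Fin m)) (f : Fin n → Fin m) : ℝ :=
  (⨆ i, (∑ j ∈ J with f j = i, (σ j).demand i) / u i)
    + ∑ i ∈ O, c i + ∑ j ∈ J, (σ j).assignCost (f j)

/-- `Z*`, the least total cost of an assignment of all the clients. -/
noncomputable def ccflOpt : ℝ :=
  ⨅ f : Fin n → Fin m, ccflCost c u σ Finset.univ (Finset.univ.image f) f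

/-- Sum over the epochs of the expected total cost in each epoch. -/
noncomputable def ccflEpochCost (A : EpochAlgorithm (Client m) m n) : ℝ :=
  ∑ k ∈ A.epochs σ,
    ∫ ω, ccflCost c u σ (A.served σ k) (A.openedIn ω σ k) (A.target ω σ) ∂A.μ

/-- Expected total cost of the solution produced for all the clients together. -/
noncomputable def ccflTotalCost (A : EpochAlgorithm (Client m) m n) : ℝ :=
  ∫ ω, ccflCost c u σ Finset.univ (A.opened ω σ) (A.target ω σ) ∂A.μ

end CCFL

section UMSC

variable {m n : ℕ} (c : Fin m → ℝ) (p : Fin n → Fin m → ℝ)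

/-- The total cost of job `j` if it is scheduled alone on machine `i`. -/
def umscSingle (j : Fin n) (i : Fin m) : ℝ :=
  c i + p j i

/-- Makespan plus start-up costs, for the jobs in `J`, the started machines `O` and the
schedule `f`. -/
noncomputable def umscCost (J : Finset (Fin n)) (O : Finset (Fin m)) (f : Fin n → Fin m) : ℝ :=
  (⨆ i, ∑ j ∈ J with f j = i, p j i) + ∑ i ∈ O, c i

/-- The least total cost of a schedule of all the jobs. -/
noncomputable def umscOpt : ℝ :=
  ⨅ f : Fin n → Fin m, umscCost c p Finset.univ (Finset.univ.image f) f

/-- Sum over the epochs of the expected total cost in each epoch. -/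
noncomputable def umscEpochCost (A : EpochAlgorithm (Fin m → ℝ) m n) : ℝ :=
  ∑ k ∈ A.epochs p,
    ∫ ω, umscCost c p (A.served p k) (A.openedIn ω p k) (A.target ω p) ∂A.μ

/-- Expected total cost of the schedule produced for all the jobs together. -/
noncomputable def umscTotalCost (A : EpochAlgorithm (Fin m → ℝ) m n) : ℝ :=
  ∫ ω, umscCost c p Finset.univ (A.opened ω p) (A.target ω p) ∂A.μ

end UMSC

/-!
Each facility carries a weight, read as the probability that it is open. An arriving client raises
the weights of the facilities that it may use, up to the least price level `τ` at which they serve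
it fractionally, and then multiplies the weights of the offered facilities by `exp (p / 10)`, where
`p` is its demand. Hence the load offered to a facility is at most `10` times the growth of the
logarithm of its weight, and each step adds at most `5 * τ` to the cost of the weights. Charging
the prices `τ` to an offline solution of normalized cost `1` bounds their sum by a constant plus a
fraction of the cost of the weights plus the growth of the logarithms of the weights that this
solution uses, which is `O(log m)`; the constant `1 / 10` makes this circular estimate contract.

The weights are rounded by one uniform threshold per facility, after scaling them up by
`1 + log (m * n)`: a client finds no offered facility open with probability at most `1 / n`, and
then uses any affordable one. Both the fractional algorithm and the charges are normalized by the
current guess `Z` of the optimum, which doubles from epoch to epoch, so that the costs of the epochs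
form a geometric series.
-/

section Preliminaries

lemma exp_sub_one_le_two_mul {x : ℝ} (h0 : 0 ≤ x) (h1 : x ≤ 1) : Real.exp x - 1 ≤ 2 * x := by
  have h := (le_abs_self _).trans (Real.abs_exp_sub_one_le (abs_le.2 ⟨by linarith, h1⟩))
  rwa [abs_of_nonneg h0] at h

lemma min_one_mul_le {x k : ℝ} (hk : 1 ≤ k) : min 1 (x * k) ≤ k * min 1 x := by
  rw [mul_min_of_nonneg _ _ (zero_le_one.trans hk), mul_one, mul_comm k x]
  exact min_le_min_right _ hk

lemma log_min_one_le_log_min_one {x y : ℝ} (hx : 0 < x) (hxy : x ≤ y) :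
    Real.log (min 1 x) ≤ Real.log (min 1 y) :=
  Real.log_le_log (lt_min one_pos hx) (min_le_min_left _ hxy)

lemma exists_subset_sum_le_two {ι : Type*} {s : Finset ι} {x : ι → ℝ} (hx : ∀ i, x i ≤ 1)
    (hs : 1 ≤ ∑ i ∈ s, x i) : ∃ t ⊆ s, 1 ≤ ∑ i ∈ t, x i ∧ ∑ i ∈ t, x i ≤ 2 := by
  classical
  induction s using Finset.induction_on with
  | empty => exact ⟨∅, subset_rfl, hs, by simp⟩
  | insert b s hb ih =>
    by_cases h : 1 ≤ ∑ i ∈ s, x i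
    · obtain ⟨t, hts, ht⟩ := ih h
      exact ⟨t, hts.trans (Finset.subset_insert b s), ht⟩
    · refine ⟨insert b s, subset_rfl, hs, ?_⟩
      rw [Finset.sum_insert hb]
      linarith [hx b]

lemma sum_sub_eq_of_stay {n : ℕ} {X M : Type*} [AddCommGroup M] {J : Finset (Fin n)} {Y : ℕ → X}
    (hstay : ∀ j : Fin n, j ∉ J → Y (j + 1) = Y j) (g : X → M) :
    ∑ j ∈ J, (g (Y (j + 1)) - g (Y j)) = g (Y n) - g (Y 0) := by
  rw [← Finset.sum_range_sub (fun t => g (Y t)) n,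
    ← Fin.sum_univ_eq_sum_range (fun t => g (Y (t + 1)) - g (Y t)) n]
  refine Finset.sum_subset (Finset.subset_univ _) fun j _ hj => ?_
  rw [hstay j hj, sub_self]

lemma sum_mul_apply_le_sum_image {α β : Type*} [DecidableEq β] {s : Finset α} {f : α → β}
    {c b : β → ℝ} {g : α → β → ℝ} (hc : ∀ i, 0 ≤ c i)
    (hg : ∀ i, ∑ j ∈ s with f j = i, g j i ≤ b i) :
    ∑ j ∈ s, c (f j) * g j (f j) ≤ ∑ i ∈ s.image f, c i * b i := by
  rw [← Finset.sum_fiberwise_of_maps_to fun j hj => Finset.mem_image_of_mem f hj]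
  refine Finset.sum_le_sum fun i _ => ?_
  calc ∑ j ∈ s with f j = i, c (f j) * g j (f j)
      = c i * ∑ j ∈ s with f j = i, g j i := by
        rw [Finset.mul_sum]
        exact Finset.sum_congr rfl fun j hj => by rw [(Finset.mem_filter.1 hj).2]
    _ ≤ c i * b i := mul_le_mul_of_nonneg_left (hg i) (hc i)

end Preliminaries

section RaisedWeight

/-- The weight `y` of a facility of charge `c` and price `q` after the client has raised it up to
the price level `τ`: beyond the level `q` the weight grows exponentially at rate `1 / c`. -/
noncomputable def raisedWeight (c q y τ : ℝ) : ℝ :=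
  y * Real.exp (max 0 (τ - q) / c)

variable {c q y τ : ℝ}

@[fun_prop]
lemma continuous_raisedWeight : Continuous (raisedWeight c q y) := by
  unfold raisedWeight
  fun_prop

lemma le_raisedWeight (hc : 0 ≤ c) (hy : 0 ≤ y) : y ≤ raisedWeight c q y τ :=
  le_mul_of_one_le_right hy (Real.one_le_exp (by positivity))

lemma raisedWeight_of_le (h : τ ≤ q) : raisedWeight c q y τ = y := by
  rw [raisedWeight, max_eq_left (sub_nonpos.2 h), zero_div, Real.exp_zero, mul_one]

lemma log_raisedWeight (hy : y ≠ 0) (h : q ≤ τ) :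
    Real.log (raisedWeight c q y τ) = Real.log y + (τ - q) / c := by
  rw [raisedWeight, Real.log_mul hy (Real.exp_ne_zero _), Real.log_exp,
    max_eq_right (sub_nonneg.2 h)]

lemma one_le_raisedWeight_add_div (hc : 0 < c) (hy : 0 < y) :
    1 ≤ raisedWeight c q y (q + c / y) := by
  rw [raisedWeight, add_sub_cancel_left, max_eq_right (by positivity), div_right_comm,
    div_self hc.ne']
  calc (1 : ℝ) = y * (1 / y) := (mul_one_div_cancel hy.ne').symm
    _ ≤ y * Real.exp (1 / y) := by gcongr; linarith [Real.add_one_le_exp (1 / y)]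

lemma charge_mul_raisedWeight_sub_le (hc : 0 < c) (hy : 0 < y) (hq : 0 ≤ q) (h : q ≤ τ) :
    c * (raisedWeight c q y τ - y) ≤ τ * raisedWeight c q y τ := by
  set r := raisedWeight c q y τ with hr
  have hr0 : 0 < r := hy.trans_le (le_raisedWeight hc.le hy.le)
  have hlog : 1 - y / r ≤ (τ - q) / c := by
    have h1 := Real.log_le_sub_one_of_pos (div_pos hy hr0)
    rw [Real.log_div hy.ne' hr0.ne', hr, log_raisedWeight hy.ne' h, ← hr] at h1
    linarith
  calc c * (r - y) = c * r * (1 - y / r) := by field_simp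
    _ ≤ c * r * ((τ - q) / c) := by gcongr
    _ = (τ - q) * r := by field_simp
    _ ≤ τ * r := by gcongr; linarith

end RaisedWeight

section SufficientLevels

variable {ι : Type*} {F : Finset ι} {c q y : ι → ℝ} {τ : ℝ}

/-- The price levels at which the facilities of `F` whose price has been reached have, once raised
to that level, total weight at least one, so that the client can be served fractionally. -/
def sufficientLevels (F : Finset ι) (c q y : ι → ℝ) : Set ℝ :=
  {τ | ∃ A ⊆ F, (∀ i ∈ A, q i ≤ τ) ∧ 1 ≤ ∑ i ∈ A, min 1 (raisedWeight (c i) (q i) (y i) τ)}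

lemma isClosed_sufficientLevels : IsClosed (sufficientLevels F c q y) := by
  have heq : sufficientLevels F c q y = ⋃ A ∈ F.powerset, (⋂ i ∈ A, Set.Ici (q i)) ∩
      {τ | 1 ≤ ∑ i ∈ A, min 1 (raisedWeight (c i) (q i) (y i) τ)} := by
    ext τ
    simp [sufficientLevels, and_left_comm]
  rw [heq]
  refine Set.Finite.isClosed_biUnion (Finset.finite_toSet _) fun A _ => ?_
  exact (isClosed_biInter fun i _ => isClosed_Ici).inter
    (isClosed_le continuous_const (by fun_prop))

lemma nonneg_of_mem_sufficientLevels (hq : ∀ i ∈ F, 0 ≤ q i)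
    (hτ : τ ∈ sufficientLevels F c q y) : 0 ≤ τ := by
  obtain ⟨A, hAF, hAq, hA⟩ := hτ
  obtain ⟨i, hi⟩ : A.Nonempty := by
    rw [Finset.nonempty_iff_ne_empty]
    rintro rfl
    norm_num at hA
  exact (hq i (hAF hi)).trans (hAq i hi)

lemma sufficientLevels_nonempty (hF : F.Nonempty) (hc : ∀ i, 0 < c i) (hy : ∀ i, 0 < y i) :
    (sufficientLevels F c q y).Nonempty := by
  obtain ⟨i, hi⟩ := hF
  refine ⟨q i + c i / y i, {i}, Finset.singleton_subset_iff.2 hi, ?_, ?_⟩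
  · simpa using (div_pos (hc i) (hy i)).le
  · rw [Finset.sum_singleton]
    exact le_min le_rfl (one_le_raisedWeight_add_div (hc i) (hy i))

lemma exists_isLeast_sufficientLevels (hF : F.Nonempty) (hc : ∀ i, 0 < c i) (hy : ∀ i, 0 < y i)
    (hq : ∀ i ∈ F, 0 ≤ q i) : ∃ τ, IsLeast (sufficientLevels F c q y) τ :=
  ⟨_, isClosed_sufficientLevels.isLeast_csInf (sufficientLevels_nonempty hF hc hy)
    ⟨0, fun _ => nonneg_of_mem_sufficientLevels hq⟩⟩

lemma sum_raisedWeight_le_one_of_notMem {B : Finset ι} (hc : ∀ i, 0 ≤ c i) (hy : ∀ i, 0 ≤ y i)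
    (hBF : B ⊆ F) (hBq : ∀ i ∈ B, q i ≤ τ) (hτ : τ ∉ sufficientLevels F c q y) :
    ∑ i ∈ B, raisedWeight (c i) (q i) (y i) τ ≤ 1 := by
  have hlt : ∑ i ∈ B, min 1 (raisedWeight (c i) (q i) (y i) τ) < 1 :=
    not_le.1 fun h => hτ ⟨B, hBF, hBq, h⟩
  refine (Finset.sum_le_sum fun i hi => ?_).trans hlt.le
  have hmin : min 1 (raisedWeight (c i) (q i) (y i) τ) < 1 :=
    (Finset.single_le_sum (f := fun i => min 1 (raisedWeight (c i) (q i) (y i) τ))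
      (fun k _ => le_min zero_le_one ((hy k).trans (le_raisedWeight (hc k) (hy k)))) hi).trans_lt
      hlt
  rw [min_eq_right ((min_lt_iff.1 hmin).resolve_left (lt_irrefl _)).le]

lemma sum_raisedWeight_le_one_of_isLeast (hc : ∀ i, 0 ≤ c i) (hy : ∀ i, 0 ≤ y i)
    (hτ : IsLeast (sufficientLevels F c q y) τ) :
    ∑ i ∈ F with q i < τ, raisedWeight (c i) (q i) (y i) τ ≤ 1 := by
  have hlim : Filter.Tendsto (fun s => ∑ i ∈ F with q i < τ, raisedWeight (c i) (q i) (y i) s)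
      (nhdsWithin τ (Set.Iio τ))
      (nhds (∑ i ∈ F with q i < τ, raisedWeight (c i) (q i) (y i) τ)) :=
    Continuous.continuousWithinAt (by fun_prop)
  have hreached : ∀ᶠ s in nhdsWithin τ (Set.Iio τ), ∀ i ∈ F.filter (q · < τ), q i ≤ s := by
    rw [Filter.eventually_all_finset]
    intro i hi
    filter_upwards [nhdsWithin_le_nhds (eventually_gt_nhds (Finset.mem_filter.1 hi).2)]
      with s hs using hs.le
  refine le_of_tendsto hlim ?_
  filter_upwards [hreached, self_mem_nhdsWithin] with s hs hlt
  exact sum_raisedWeight_le_one_of_notMem hc hy (Finset.filter_subset _ _) hs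
    fun h => (hτ.2 h).not_gt hlt

end SufficientLevels

section FractionalStep

variable {ι : Type*} [Fintype ι] {c a p q y h : ι → ℝ} {F E : Finset ι} {τ : ℝ}

/-- First half of a step of the fractional algorithm: the weights `y` are raised to `h` at the
price level `τ`, where facility `i` asks for the price `q i`, and the facilities in `E` are offered
to the client. The weight of a facility counts as an opening probability only up to one. -/
structure IsRaise (c q : ι → ℝ) (F : Finset ι) (y h : ι → ℝ) (E : Finset ι) (τ : ℝ) : Prop where
  price_nonneg : 0 ≤ τ
  le_raised : ∀ i, y i ≤ h i
  subset : E ⊆ F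
  le_price : ∀ i ∈ E, q i ≤ τ
  one_le_sum : 1 ≤ ∑ i ∈ E, min 1 (h i)
  sum_le_two : ∑ i ∈ E, min 1 (h i) ≤ 2
  max_one : ∀ i, max 1 (h i) = max 1 (y i)
  charge : ∑ i, c i * h i ≤ ∑ i, c i * y i + τ
  price_le : ∀ i ∈ F, τ ≤ q i + c i * (Real.log (min 1 (h i)) - Real.log (min 1 (y i)))

lemma sum_mul_piecewise_le [DecidableEq ι] {B : Finset ι} {r : ι → ℝ} (hτ : 0 ≤ τ)
    (hr : ∑ i ∈ B, r i ≤ 1) (hrτ : ∀ i ∈ B, c i * (r i - y i) ≤ τ * r i) :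
    ∑ i, c i * B.piecewise r y i ≤ ∑ i, c i * y i + τ := by
  rw [← sub_le_iff_le_add', ← Finset.sum_sub_distrib]
  calc ∑ i, (c i * B.piecewise r y i - c i * y i) = ∑ i ∈ B, c i * (r i - y i) := by
        rw [← Finset.sum_subset (Finset.subset_univ B) fun i _ hi => by simp [hi]]
        exact Finset.sum_congr rfl fun i hi => by simp [hi, mul_sub]
    _ ≤ τ * ∑ i ∈ B, r i := by
        rw [Finset.mul_sum]
        exact Finset.sum_le_sum hrτ
    _ ≤ τ := mul_le_of_le_one_right hτ hr

lemma exists_isRaise (hF : F.Nonempty) (hc : ∀ i, 0 < c i) (hy : ∀ i, 0 < y i)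
    (hq : ∀ i ∈ F, 0 ≤ q i) : ∃ h E τ, IsRaise c q F y h E τ := by
  classical
  obtain ⟨τ, hτ⟩ := exists_isLeast_sufficientLevels hF hc hy hq
  have hτ0 : 0 ≤ τ := nonneg_of_mem_sufficientLevels hq hτ.1
  have hsum := sum_raisedWeight_le_one_of_isLeast (fun i => (hc i).le) (fun i => (hy i).le) hτ
  set r : ι → ℝ := fun i => raisedWeight (c i) (q i) (y i) τ
  set B := F.filter (q · < τ)
  have hyr : ∀ i, y i ≤ r i := fun i => le_raisedWeight (hc i).le (hy i).le
  have hr1 : ∀ i ∈ B, r i ≤ 1 := fun i hi =>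
    (Finset.single_le_sum (fun k _ => (hy k).le.trans (hyr k)) hi).trans hsum
  have hBF : ∀ i ∈ F, i ∉ B → τ ≤ q i := fun i hi hiB =>
    not_lt.1 fun h => hiB (Finset.mem_filter.2 ⟨hi, h⟩)
  obtain ⟨A, hAF, hAq, hA⟩ := hτ.1
  obtain ⟨E, hEA, hE1, hE2⟩ := exists_subset_sum_le_two (fun i => min_le_left 1 (r i)) hA
  have hEr : ∑ i ∈ E, min 1 (B.piecewise r y i) = ∑ i ∈ E, min 1 (r i) := by
    refine Finset.sum_congr rfl fun i hi => ?_
    by_cases hiB : i ∈ B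
    · rw [Finset.piecewise_eq_of_mem _ _ _ hiB]
    · have hri : r i = y i := raisedWeight_of_le (hBF i (hAF (hEA hi)) hiB)
      rw [Finset.piecewise_eq_of_notMem _ _ _ hiB, hri]
  refine ⟨B.piecewise r y, E, τ, hτ0, fun i => ?_, hEA.trans hAF, fun i hi => hAq i (hEA hi),
    hEr ▸ hE1, hEr ▸ hE2, fun i => ?_, sum_mul_piecewise_le hτ0 hsum fun i hi => ?_,
    fun i hi => ?_⟩
  · by_cases hiB : i ∈ B <;> simp [hiB, hyr]
  · by_cases hiB : i ∈ B
    · simp [hiB, hr1 i hiB, (hyr i).trans (hr1 i hiB)]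
    · simp [hiB]
  · obtain ⟨hiF, hiq⟩ := Finset.mem_filter.1 hi
    exact charge_mul_raisedWeight_sub_le (hc i) (hy i) (hq i hiF) hiq.le
  · by_cases hiB : i ∈ B
    · rw [Finset.piecewise_eq_of_mem _ _ _ hiB, min_eq_right (hr1 i hiB),
        min_eq_right ((hyr i).trans (hr1 i hiB)),
        log_raisedWeight (hy i).ne' (Finset.mem_filter.1 hiB).2.le, add_sub_cancel_left,
        mul_div_cancel₀ _ (hc i).ne', add_sub_cancel]
    · simpa [hiB] using hBF i hi hiB

/-- The price that a facility of weight `y`, charge `c` and assignment cost `a` asks from a client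
of demand `p`. The constant `1 / 10` makes the circular estimate in `FractionalRun.sum_price_le`
contract. -/
noncomputable def askingPrice (c a p y : ℝ) : ℝ :=
  a + c * p * max 1 y / 10

lemma askingPrice_nonneg {c a p y : ℝ} (hc : 0 ≤ c) (ha : 0 ≤ a) (hp : 0 ≤ p) :
    0 ≤ askingPrice c a p y := by
  unfold askingPrice
  positivity

lemma charge_mul_bump_sub_le {c a p y h : ℝ} (hc : 0 ≤ c) (ha : 0 ≤ a) (hp : 0 ≤ p) (hp1 : p ≤ 1)
    (hh : 0 ≤ h) (hmax : max 1 h = max 1 y) :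
    c * (h * Real.exp (p / 10) - h) ≤ 2 * (min 1 h * askingPrice c a p y) :=
  calc c * (h * Real.exp (p / 10) - h) = c * h * (Real.exp (p / 10) - 1) := by ring
    _ ≤ c * h * (2 * (p / 10)) := by
        gcongr
        exact exp_sub_one_le_two_mul (by positivity) (by linarith)
    _ = 2 * (min 1 h * (c * p * max 1 y / 10)) := by
        rw [← hmax]
        linear_combination (-(c * p / 5)) * min_mul_max 1 h
    _ ≤ 2 * (min 1 h * askingPrice c a p y) := by
        have := le_min zero_le_one hh
        unfold askingPrice
        gcongr
        exact le_add_of_nonneg_left ha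

lemma assignCost_mul_min_bump_le {c a p y h : ℝ} (hc : 0 ≤ c) (ha : 0 ≤ a) (hp : 0 ≤ p)
    (hp1 : p ≤ 1) (hh : 0 ≤ h) :
    a * min 1 (h * Real.exp (p / 10)) ≤ 2 * (min 1 h * askingPrice c a p y) := by
  have : 0 ≤ min 1 h := le_min zero_le_one hh
  have hexp : Real.exp (p / 10) ≤ 2 := by
    linarith [exp_sub_one_le_two_mul (x := p / 10) (by positivity) (by linarith)]
  calc a * min 1 (h * Real.exp (p / 10)) ≤ a * (Real.exp (p / 10) * min 1 h) := by
        gcongr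
        exact min_one_mul_le (Real.one_le_exp (by positivity))
    _ ≤ a * (2 * min 1 h) := by gcongr
    _ = 2 * (min 1 h * a) := by ring
    _ ≤ 2 * (min 1 h * askingPrice c a p y) := by
        unfold askingPrice
        gcongr
        exact le_add_of_nonneg_right (by positivity)

/-- One step of the fractional algorithm, with normalized charges `c`: a client with assignment
costs `a` and demands `p`, which may use the facilities in `F`, turns the weights `y` into `y'` and
is offered the facilities in `E`; `τ` is the price that it pays. -/
structure IsFractionalStep (c a p : ι → ℝ) (F : Finset ι) (y y' : ι → ℝ) (E : Finset ι)
    (τ : ℝ) : Prop where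
  le_next : ∀ i, y i ≤ y' i
  subset : E ⊆ F
  growth : ∀ i ∈ E, y i * Real.exp (p i / 10) ≤ y' i
  cover : 1 ≤ ∑ i ∈ E, min 1 (y' i)
  charge : ∑ i, c i * y' i ≤ ∑ i, c i * y i + 5 * τ
  assign : ∑ i ∈ E, a i * min 1 (y' i) ≤ 4 * τ
  price_le : ∀ i ∈ F, τ ≤ askingPrice (c i) (a i) (p i) (y i)
    + c i * (Real.log (min 1 (y' i)) - Real.log (min 1 (y i)))

namespace IsRaise

lemma sum_min_mul_le (H : IsRaise c q F y h E τ) (hy : ∀ i, 0 ≤ y i) :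
    ∑ i ∈ E, min 1 (h i) * q i ≤ 2 * τ :=
  calc ∑ i ∈ E, min 1 (h i) * q i ≤ ∑ i ∈ E, min 1 (h i) * τ :=
        Finset.sum_le_sum fun i hi => mul_le_mul_of_nonneg_left (H.le_price i hi)
          (le_min zero_le_one ((hy i).trans (H.le_raised i)))
    _ = (∑ i ∈ E, min 1 (h i)) * τ := (Finset.sum_mul _ _ _).symm
    _ ≤ 2 * τ := mul_le_mul_of_nonneg_right H.sum_le_two H.price_nonneg

lemma sum_bump_sub_le [DecidableEq ι]
    (H : IsRaise c (fun i => askingPrice (c i) (a i) (p i) (y i)) F y h E τ) (hc : ∀ i, 0 ≤ c i)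
    (hy : ∀ i, 0 ≤ y i) (ha : ∀ i ∈ F, 0 ≤ a i) (hp : ∀ i ∈ F, 0 ≤ p i) (hp1 : ∀ i ∈ F, p i ≤ 1) :
    ∑ i, c i * E.piecewise (fun i => h i * Real.exp (p i / 10)) h i - ∑ i, c i * h i ≤ 4 * τ := by
  rw [← Finset.sum_sub_distrib]
  calc ∑ i, (c i * E.piecewise (fun i => h i * Real.exp (p i / 10)) h i - c i * h i)
      = ∑ i ∈ E, c i * (h i * Real.exp (p i / 10) - h i) := by
        rw [← Finset.sum_subset (Finset.subset_univ E) fun i _ hi => by simp [hi]]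
        exact Finset.sum_congr rfl fun i hi => by simp [hi, mul_sub]
    _ ≤ ∑ i ∈ E, 2 * (min 1 (h i) * askingPrice (c i) (a i) (p i) (y i)) :=
        Finset.sum_le_sum fun i hi => charge_mul_bump_sub_le (hc i) (ha i (H.subset hi))
          (hp i (H.subset hi)) (hp1 i (H.subset hi)) ((hy i).trans (H.le_raised i)) (H.max_one i)
    _ ≤ 4 * τ := by
        rw [← Finset.mul_sum]
        linarith [H.sum_min_mul_le hy]

/-- Second half of a step: the weights of the offered facilities are multiplied by an exponential
in the demand, so that the logarithm of a weight bounds the demand offered to the facility. -/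
theorem isFractionalStep [DecidableEq ι]
    (H : IsRaise c (fun i => askingPrice (c i) (a i) (p i) (y i)) F y h E τ) (hc : ∀ i, 0 ≤ c i)
    (hy : ∀ i, 0 < y i) (ha : ∀ i ∈ F, 0 ≤ a i) (hp : ∀ i ∈ F, 0 ≤ p i) (hp1 : ∀ i ∈ F, p i ≤ 1) :
    IsFractionalStep c a p F y (E.piecewise (fun i => h i * Real.exp (p i / 10)) h) E τ := by
  have hh : ∀ i, 0 < h i := fun i => (hy i).trans_le (H.le_raised i)
  have hbump : ∀ i, h i ≤ E.piecewise (fun i => h i * Real.exp (p i / 10)) h i := fun i => by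
    by_cases hi : i ∈ E
    · rw [Finset.piecewise_eq_of_mem _ _ _ hi]
      exact le_mul_of_one_le_right (hh i).le
        (Real.one_le_exp (div_nonneg (hp i (H.subset hi)) (by norm_num)))
    · rw [Finset.piecewise_eq_of_notMem _ _ _ hi]
  refine ⟨fun i => (H.le_raised i).trans (hbump i), H.subset, fun i hi => ?_,
    H.one_le_sum.trans (Finset.sum_le_sum fun i _ => min_le_min_left _ (hbump i)), ?_, ?_,
    fun i hi => (H.price_le i hi).trans ?_⟩
  · rw [Finset.piecewise_eq_of_mem _ _ _ hi]
    gcongr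
    exact H.le_raised i
  · linarith [H.charge, H.sum_bump_sub_le hc (fun i => (hy i).le) ha hp hp1]
  · calc ∑ i ∈ E, a i * min 1 (E.piecewise (fun i => h i * Real.exp (p i / 10)) h i)
        ≤ ∑ i ∈ E, 2 * (min 1 (h i) * askingPrice (c i) (a i) (p i) (y i)) := by
          refine Finset.sum_le_sum fun i hi => ?_
          have hiF := H.subset hi
          rw [Finset.piecewise_eq_of_mem _ _ _ hi]
          exact assignCost_mul_min_bump_le (hc i) (ha i hiF) (hp i hiF) (hp1 i hiF) (hh i).le
      _ ≤ 4 * τ := by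
          rw [← Finset.mul_sum]
          linarith [H.sum_min_mul_le fun i => (hy i).le]
  · have := log_min_one_le_log_min_one (hh i) (hbump i)
    have := hc i
    gcongr

end IsRaise

theorem exists_isFractionalStep (hF : F.Nonempty) (hc : ∀ i, 0 < c i) (hy : ∀ i, 0 < y i)
    (ha : ∀ i ∈ F, 0 ≤ a i) (hp : ∀ i ∈ F, 0 ≤ p i) (hp1 : ∀ i ∈ F, p i ≤ 1) :
    ∃ y' E τ, IsFractionalStep c a p F y y' E τ := by
  classical
  obtain ⟨h, E, τ, H⟩ := exists_isRaise (q := fun i => askingPrice (c i) (a i) (p i) (y i)) hF hc hy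
    fun i hi => askingPrice_nonneg (hc i).le (ha i hi) (hp i hi)
  exact ⟨_, E, τ, H.isFractionalStep (fun i => (hc i).le) hy ha hp hp1⟩

end FractionalStep

/-- A run of the fractional algorithm over the `clients` of one epoch, in normalized units; the
`weight` at time `t` is the one in force when client `t` arrives, and the `benchmark` is an
assignment of the clients of normalized cost at most one. The charges have been raised to at least
`1 / card ι` each, which adds at most one to the opening cost of the benchmark. -/
structure FractionalRun (ι : Type*) [Fintype ι] [DecidableEq ι] (n : ℕ) where
  charge : ι → ℝ
  assignCost : Fin n → ι → ℝ
  demand : Fin n → ι → ℝ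
  clients : Finset (Fin n)
  allowed : Fin n → Finset ι
  offered : Fin n → Finset ι
  weight : ℕ → ι → ℝ
  price : Fin n → ℝ
  benchmark : Fin n → ι
  inv_card_le_charge : ∀ i, (Fintype.card ι : ℝ)⁻¹ ≤ charge i
  charge_le_one : ∀ i, charge i ≤ 1
  demand_nonneg : ∀ j i, 0 ≤ demand j i
  demand_le_one : ∀ j, ∀ i ∈ allowed j, demand j i ≤ 1
  assignCost_nonneg : ∀ j i, 0 ≤ assignCost j i
  assignCost_le_one : ∀ j, ∀ i ∈ allowed j, assignCost j i ≤ 1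
  weight_zero : ∀ i, weight 0 i = (Fintype.card ι : ℝ)⁻¹
  step : ∀ j ∈ clients, IsFractionalStep charge (assignCost j) (demand j) (allowed j)
    (weight j) (weight (j + 1)) (offered j) (price j)
  stay : ∀ j : Fin n, j ∉ clients → weight (j + 1) = weight j
  benchmark_mem : ∀ j ∈ clients, benchmark j ∈ allowed j
  benchmark_load : ∀ i, ∑ j ∈ clients with benchmark j = i, demand j i ≤ 1
  benchmark_assignCost : ∑ j ∈ clients, assignCost j (benchmark j) ≤ 1
  benchmark_charge : ∑ i ∈ clients.image benchmark, charge i ≤ 2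

namespace FractionalRun

variable {ι : Type*} [Fintype ι] [DecidableEq ι] {n : ℕ} (H : FractionalRun ι n)

lemma weight_le_succ (j : Fin n) (i : ι) : H.weight j i ≤ H.weight (j + 1) i := by
  by_cases hj : j ∈ H.clients
  · exact (H.step j hj).le_next i
  · rw [H.stay j hj]

lemma weight_mono {s t : ℕ} (hst : s ≤ t) (ht : t ≤ n) (i : ι) : H.weight s i ≤ H.weight t i := by
  induction t, hst using Nat.le_induction with
  | base => exact le_rfl
  | succ t _ ih => exact (ih (by omega)).trans (H.weight_le_succ ⟨t, by omega⟩ i)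

lemma charge_pos (i : ι) : 0 < H.charge i :=
  (inv_pos.2 (Nat.cast_pos.2 (Fintype.card_pos_iff.2 ⟨i⟩))).trans_le (H.inv_card_le_charge i)

lemma weight_pos {t : ℕ} (ht : t ≤ n) (i : ι) : 0 < H.weight t i := by
  refine lt_of_lt_of_le ?_ (H.weight_mono t.zero_le ht i)
  rw [H.weight_zero]
  exact inv_pos.2 (Nat.cast_pos.2 (Fintype.card_pos_iff.2 ⟨i⟩))

lemma charge_mul_weight_nonneg (i : ι) : 0 ≤ H.charge i * H.weight n i :=
  mul_nonneg (H.charge_pos i).le (H.weight_pos le_rfl i).le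

lemma sum_charge_mul_weight_le_price :
    ∑ i, H.charge i * H.weight n i ≤ 1 + 5 * ∑ j ∈ H.clients, H.price j := by
  have hstart : ∑ i, H.charge i * H.weight 0 i ≤ 1 :=
    calc ∑ i, H.charge i * H.weight 0 i ≤ ∑ _i : ι, (Fintype.card ι : ℝ)⁻¹ :=
          Finset.sum_le_sum fun i _ => by
            rw [H.weight_zero]
            exact mul_le_of_le_one_left (by positivity) (H.charge_le_one i)
      _ ≤ 1 := by
          rw [Finset.sum_const, Finset.card_univ, nsmul_eq_mul]
          exact mul_inv_le_one
  have hsteps : ∑ j ∈ H.clients, (∑ i, H.charge i * H.weight (j + 1) i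
      - ∑ i, H.charge i * H.weight j i) ≤ ∑ j ∈ H.clients, 5 * H.price j :=
    Finset.sum_le_sum fun j hj => sub_le_iff_le_add'.2 (H.step j hj).charge
  rw [sum_sub_eq_of_stay H.stay fun y => ∑ i, H.charge i * y i, ← Finset.mul_sum] at hsteps
  linarith

lemma sum_askingPrice_benchmark_le :
    ∑ j ∈ H.clients, askingPrice (H.charge (H.benchmark j)) (H.assignCost j (H.benchmark j))
        (H.demand j (H.benchmark j)) (H.weight j (H.benchmark j))
      ≤ 1 + (2 + ∑ i, H.charge i * H.weight n i) / 10 := by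
  have hload : ∑ j ∈ H.clients, H.charge (H.benchmark j) *
      (H.demand j (H.benchmark j) * max 1 (H.weight j (H.benchmark j)))
      ≤ ∑ i ∈ H.clients.image H.benchmark, H.charge i * (1 + H.weight n i) := by
    refine sum_mul_apply_le_sum_image (f := H.benchmark)
      (g := fun j i => H.demand j i * max 1 (H.weight j i)) (fun i => (H.charge_pos i).le)
      fun i => ?_
    have hn := H.weight_pos le_rfl i
    calc ∑ j ∈ H.clients with H.benchmark j = i, H.demand j i * max 1 (H.weight j i)
        ≤ ∑ j ∈ H.clients with H.benchmark j = i, H.demand j i * (1 + H.weight n i) :=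
          Finset.sum_le_sum fun j _ => mul_le_mul_of_nonneg_left
            (max_le (by linarith) (by linarith [H.weight_mono j.2.le le_rfl i]))
            (H.demand_nonneg j i)
      _ ≤ 1 + H.weight n i := by
          rw [← Finset.sum_mul]
          exact mul_le_of_le_one_left (by positivity) (H.benchmark_load i)
  have hopen : ∑ i ∈ H.clients.image H.benchmark, H.charge i * (1 + H.weight n i)
      ≤ 2 + ∑ i, H.charge i * H.weight n i := by
    simp only [mul_add, mul_one, Finset.sum_add_distrib]
    exact add_le_add H.benchmark_charge (Finset.sum_le_sum_of_subset_of_nonneg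
      (Finset.subset_univ _) fun i _ _ => H.charge_mul_weight_nonneg i)
  simp only [askingPrice, Finset.sum_add_distrib, ← Finset.sum_div, mul_assoc]
  linarith [H.benchmark_assignCost]

lemma sum_log_min_weight_sub_le (i : ι) :
    ∑ j ∈ H.clients with H.benchmark j = i,
        (Real.log (min 1 (H.weight (j + 1) i)) - Real.log (min 1 (H.weight j i)))
      ≤ Real.log (Fintype.card ι) := by
  have hcard : (Fintype.card ι : ℝ)⁻¹ ≤ 1 := (H.inv_card_le_charge i).trans (H.charge_le_one i)
  calc ∑ j ∈ H.clients with H.benchmark j = i,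
        (Real.log (min 1 (H.weight (j + 1) i)) - Real.log (min 1 (H.weight j i)))
      ≤ ∑ j ∈ H.clients,
          (Real.log (min 1 (H.weight (j + 1) i)) - Real.log (min 1 (H.weight j i))) :=
        Finset.sum_le_sum_of_subset_of_nonneg (Finset.filter_subset _ _) fun j _ _ =>
          sub_nonneg.2 (log_min_one_le_log_min_one (H.weight_pos j.2.le i) (H.weight_le_succ j i))
    _ = Real.log (min 1 (H.weight n i)) - Real.log (min 1 (H.weight 0 i)) :=
        sum_sub_eq_of_stay H.stay fun y => Real.log (min 1 (y i))
    _ ≤ Real.log (Fintype.card ι) := by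
        rw [H.weight_zero, min_eq_right hcard, Real.log_inv, sub_neg_eq_add]
        exact add_le_of_nonpos_left (Real.log_nonpos
          (le_min zero_le_one (H.weight_pos le_rfl i).le) (min_le_left _ _))

lemma sum_log_increase_benchmark_le :
    ∑ j ∈ H.clients, H.charge (H.benchmark j) *
        (Real.log (min 1 (H.weight (j + 1) (H.benchmark j)))
          - Real.log (min 1 (H.weight j (H.benchmark j))))
      ≤ 2 * Real.log (Fintype.card ι) :=
  calc _ ≤ ∑ i ∈ H.clients.image H.benchmark, H.charge i * Real.log (Fintype.card ι) :=
        sum_mul_apply_le_sum_image (f := H.benchmark) (g := fun j i =>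
          Real.log (min 1 (H.weight (j + 1) i)) - Real.log (min 1 (H.weight j i)))
          (fun i => (H.charge_pos i).le) H.sum_log_min_weight_sub_le
    _ ≤ 2 * Real.log (Fintype.card ι) := by
        rw [← Finset.sum_mul]
        exact mul_le_mul_of_nonneg_right H.benchmark_charge (Real.log_natCast_nonneg _)

theorem sum_price_le : ∑ j ∈ H.clients, H.price j ≤ 3 + 4 * Real.log (Fintype.card ι) := by
  have hprice := Finset.sum_le_sum fun j hj =>
    (H.step j hj).price_le (H.benchmark j) (H.benchmark_mem j hj)
  rw [Finset.sum_add_distrib] at hprice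
  linarith [H.sum_askingPrice_benchmark_le, H.sum_log_increase_benchmark_le,
    H.sum_charge_mul_weight_le_price]

theorem sum_charge_mul_weight_le :
    ∑ i, H.charge i * H.weight n i ≤ 16 + 20 * Real.log (Fintype.card ι) := by
  linarith [H.sum_charge_mul_weight_le_price, H.sum_price_le]

lemma sum_offered_demand_le_log_weight (i : ι) :
    (∑ j ∈ H.clients with i ∈ H.offered j, H.demand j i) / 10
      ≤ Real.log (H.weight n i) + Real.log (Fintype.card ι) := by
  calc (∑ j ∈ H.clients with i ∈ H.offered j, H.demand j i) / 10
      = ∑ j ∈ H.clients, if i ∈ H.offered j then H.demand j i / 10 else 0 := by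
        rw [Finset.sum_div, Finset.sum_filter]
    _ ≤ ∑ j ∈ H.clients, (Real.log (H.weight (j + 1) i) - Real.log (H.weight j i)) := by
        refine Finset.sum_le_sum fun j hj => ?_
        have hpos := H.weight_pos j.2.le i
        split_ifs with hi
        · have hgrowth := Real.log_le_log (by positivity) ((H.step j hj).growth i hi)
          rw [Real.log_mul hpos.ne' (Real.exp_ne_zero _), Real.log_exp] at hgrowth
          linarith
        · exact sub_nonneg.2 (Real.log_le_log hpos (H.weight_le_succ j i))
    _ = Real.log (H.weight n i) + Real.log (Fintype.card ι) := by
        rw [sum_sub_eq_of_stay H.stay fun y => Real.log (y i), H.weight_zero, Real.log_inv,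
          sub_neg_eq_add]

theorem sum_offered_demand_le (i : ι) :
    ∑ j ∈ H.clients with i ∈ H.offered j, H.demand j i
      ≤ 160 + 220 * Real.log (Fintype.card ι) := by
  have hcard : (0 : ℝ) < (Fintype.card ι : ℝ) := Nat.cast_pos.2 (Fintype.card_pos_iff.2 ⟨i⟩)
  have hpos := H.weight_pos le_rfl i
  have hweight : (Fintype.card ι : ℝ)⁻¹ * H.weight n i ≤ 16 + 20 * Real.log (Fintype.card ι) :=
    calc (Fintype.card ι : ℝ)⁻¹ * H.weight n i ≤ H.charge i * H.weight n i := by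
          gcongr
          exact H.inv_card_le_charge i
      _ ≤ ∑ k, H.charge k * H.weight n k :=
          Finset.single_le_sum (f := fun k => H.charge k * H.weight n k)
            (fun k _ => H.charge_mul_weight_nonneg k) (Finset.mem_univ i)
      _ ≤ _ := H.sum_charge_mul_weight_le
  have hlog := Real.log_le_sub_one_of_pos (show 0 < (Fintype.card ι : ℝ)⁻¹ * H.weight n i by
    positivity)
  rw [Real.log_mul (by positivity) hpos.ne', Real.log_inv] at hlog
  linarith [H.sum_offered_demand_le_log_weight i]

end FractionalRun

section Thresholds

variable {ι : Type*} {K : ℝ} {y : ι → ℝ}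

/-- The thresholds at which facility `i` is open for a client that sees the weights `y`; the weights
are scaled up by `K` in order to make misses rare. -/
def openEvent (K : ℝ) (y : ι → ℝ) (i : ι) : Set (ι → ℝ) :=
  {ω | ω i ≤ K * y i}

/-- The thresholds at which no facility of `E` is open for a client that sees the weights `y`. -/
def missEvent (K : ℝ) (E : Finset ι) (y : ι → ℝ) : Set (ι → ℝ) :=
  {ω | ∀ i ∈ E, ω ∉ openEvent K y i}

lemma measurableSet_openEvent (i : ι) : MeasurableSet (openEvent K y i) :=
  measurableSet_le (measurable_pi_apply i) measurable_const

lemma measurableSet_missEvent (E : Finset ι) : MeasurableSet (missEvent K E y) := by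
  simp only [missEvent, Set.ofPred_forall]
  exact E.measurableSet_biInter fun i _ => (measurableSet_openEvent i).compl

variable [Fintype ι]

instance isProbabilityMeasure_restrict_Icc :
    IsProbabilityMeasure ((volume : Measure ℝ).restrict (Set.Icc (0 : ℝ) 1)) :=
  ⟨by simp⟩

/-- The law of independent thresholds, one for each facility, uniform in the unit interval. -/
noncomputable def thresholdMeasure (ι : Type*) [Fintype ι] : Measure (ι → ℝ) :=
  Measure.pi fun _ => volume.restrict (Set.Icc (0 : ℝ) 1)

instance isProbabilityMeasure_thresholdMeasure : IsProbabilityMeasure (thresholdMeasure ι) := by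
  unfold thresholdMeasure
  infer_instance

lemma measureReal_openEvent_le {i : ι} (hK : 1 ≤ K) (hy : 0 ≤ y i) :
    (thresholdMeasure ι).real (openEvent K y i) ≤ K * min 1 (y i) := by
  have hmeas : MeasurableSet (Set.Iic (K * y i)) := measurableSet_Iic
  have hle : (thresholdMeasure ι).real (openEvent K y i) ≤ K * y i := by
    have heval : thresholdMeasure ι (openEvent K y i)
        = (volume : Measure ℝ).restrict (Set.Icc (0 : ℝ) 1) (Set.Iic (K * y i)) :=
      (measurePreserving_eval
        (fun _ : ι => (volume : Measure ℝ).restrict (Set.Icc (0 : ℝ) 1)) i).measure_preimage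
        hmeas.nullMeasurableSet
    rw [Measure.real, heval, Measure.restrict_apply hmeas]
    refine ENNReal.toReal_le_of_le_ofReal (by positivity) ?_
    calc volume (Set.Iic (K * y i) ∩ Set.Icc 0 1) ≤ volume (Set.Icc 0 (K * y i)) :=
          measure_mono fun x hx => ⟨hx.2.1, hx.1⟩
      _ = ENNReal.ofReal (K * y i) := by simp
  calc (thresholdMeasure ι).real (openEvent K y i) ≤ min 1 (y i * K) :=
        le_min measureReal_le_one (hle.trans_eq (mul_comm _ _))
    _ ≤ K * min 1 (y i) := min_one_mul_le hK

lemma volume_restrict_Ioi_le {t : ℝ} (hK : 0 ≤ K) :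
    (volume : Measure ℝ).restrict (Set.Icc (0 : ℝ) 1) (Set.Ioi (K * t))
      ≤ ENNReal.ofReal (Real.exp (-(K * min 1 t))) := by
  rw [Measure.restrict_apply measurableSet_Ioi]
  calc volume (Set.Ioi (K * t) ∩ Set.Icc 0 1) ≤ volume (Set.Icc (K * t) 1) :=
        measure_mono fun x hx => ⟨le_of_lt hx.1, hx.2.2⟩
    _ = ENNReal.ofReal (1 - K * t) := by simp
    _ ≤ _ := by
        refine ENNReal.ofReal_le_ofReal ?_
        have hmin : K * min 1 t ≤ K * t := mul_le_mul_of_nonneg_left (min_le_right _ _) hK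
        linarith [Real.add_one_le_exp (-(K * min 1 t))]

lemma measureReal_missEvent_le {E : Finset ι} (hK : 0 ≤ K) (hE : 1 ≤ ∑ i ∈ E, min 1 (y i)) :
    (thresholdMeasure ι).real (missEvent K E y) ≤ Real.exp (-K) := by
  classical
  have hpi : missEvent K E y
      = Set.univ.pi fun i => if i ∈ E then Set.Ioi (K * y i) else Set.univ := by
    ext ω
    simp only [missEvent, openEvent, Set.mem_ofPred_eq, not_le, Set.mem_univ_pi]
    refine forall_congr' fun i => ?_
    split_ifs with hi <;> simp [hi]
  rw [Measure.real, hpi, thresholdMeasure, Measure.pi_pi]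
  refine ENNReal.toReal_le_of_le_ofReal (Real.exp_pos _).le ?_
  calc ∏ i, (volume : Measure ℝ).restrict (Set.Icc (0 : ℝ) 1)
          (if i ∈ E then Set.Ioi (K * y i) else Set.univ)
      ≤ ∏ i, (if i ∈ E then ENNReal.ofReal (Real.exp (-(K * min 1 (y i)))) else 1) := by
        refine Finset.prod_le_prod' fun i _ => ?_
        split_ifs
        · exact volume_restrict_Ioi_le hK
        · exact prob_le_one
    _ = ENNReal.ofReal (∏ i ∈ E, Real.exp (-(K * min 1 (y i)))) := by
        rw [Finset.prod_ite_mem, Finset.univ_inter,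
          ENNReal.ofReal_prod_of_nonneg fun i _ => (Real.exp_pos _).le]
    _ ≤ ENNReal.ofReal (Real.exp (-K)) := by
        refine ENNReal.ofReal_le_ofReal ?_
        rw [← Real.exp_sum, Finset.sum_neg_distrib, ← Finset.mul_sum]
        exact Real.exp_le_exp.2 (neg_le_neg (le_mul_of_one_le_right hK hE))

end Thresholds

section SumIndicator

variable {α Ω : Type*} [MeasurableSpace Ω] {μ : Measure Ω} [IsFiniteMeasure μ] {s : Finset α}
  {S : α → Set Ω}

lemma integrable_sum_indicator_const (b : α → ℝ) (hS : ∀ x, MeasurableSet (S x)) :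
    Integrable (fun ω => ∑ x ∈ s, (S x).indicator (fun _ => b x) ω) μ :=
  integrable_finsetSum _ fun x _ => (integrable_const (b x)).indicator (hS x)

lemma integral_sum_indicator_const (b : α → ℝ) (hS : ∀ x, MeasurableSet (S x)) :
    ∫ ω, ∑ x ∈ s, (S x).indicator (fun _ => b x) ω ∂μ = ∑ x ∈ s, μ.real (S x) * b x := by
  rw [integral_finsetSum _ fun x _ => (integrable_const (b x)).indicator (hS x)]
  exact Finset.sum_congr rfl fun x _ => by rw [integral_indicator_const _ (hS x), smul_eq_mul]

end SumIndicator

namespace FractionalRun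

variable {ι : Type*} [Fintype ι] [DecidableEq ι] {n : ℕ} (H : FractionalRun ι n) {K : ℝ}
  {ω : ι → ℝ} {g : Fin n → ι}

/-- `g` assigns the clients according to the thresholds `ω`: each client goes to an offered
facility that is open for it, or to an arbitrary allowed one if there is none. -/
structure IsRounding (K : ℝ) (ω : ι → ℝ) (g : Fin n → ι) : Prop where
  mem_allowed : ∀ j ∈ H.clients, g j ∈ H.allowed j
  mem_offered : ∀ j ∈ H.clients, ω ∉ missEvent K (H.offered j) (H.weight (j + 1)) →
    g j ∈ H.offered j
  mem_openEvent : ∀ j ∈ H.clients, ω ∉ missEvent K (H.offered j) (H.weight (j + 1)) →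
    ω ∈ openEvent K (H.weight (j + 1)) (g j)

/-- The number of clients for which no offered facility is open. -/
noncomputable def missCount (K : ℝ) (ω : ι → ℝ) : ℝ :=
  ∑ j ∈ H.clients, (missEvent K (H.offered j) (H.weight (j + 1))).indicator (fun _ => 1) ω

/-- The charges of the facilities that are open for a client that sees the final weights. -/
noncomputable def openCharge (K : ℝ) (ω : ι → ℝ) : ℝ :=
  ∑ i, (openEvent K (H.weight n) i).indicator (fun _ => H.charge i) ω

/-- The assignment costs of all pairs of a client and an offered facility that is open for it. -/
noncomputable def openAssignCost (K : ℝ) (ω : ι → ℝ) : ℝ :=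
  ∑ x ∈ H.clients.sigma H.offered,
    (openEvent K (H.weight (x.1 + 1)) x.2).indicator (fun _ => H.assignCost x.1 x.2) ω

/-- A bound for the normalized cost of every rounding with thresholds `ω`. -/
noncomputable def roundingBound (K : ℝ) (ω : ι → ℝ) : ℝ :=
  160 + 220 * Real.log (Fintype.card ι) + H.openCharge K ω + H.openAssignCost K ω
    + 3 * H.missCount K ω

variable {H}

namespace IsRounding

lemma sum_demand_le (hg : H.IsRounding K ω g) (i : ι) :
    ∑ j ∈ H.clients with g j = i, H.demand j i
      ≤ 160 + 220 * Real.log (Fintype.card ι) + H.missCount K ω := by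
  refine le_trans ?_ (add_le_add_left (H.sum_offered_demand_le i) _)
  rw [missCount, Finset.sum_filter, Finset.sum_filter, ← Finset.sum_add_distrib]
  refine Finset.sum_le_sum fun j hj => ?_
  have hd := H.demand_nonneg j i
  by_cases hω : ω ∈ missEvent K (H.offered j) (H.weight (j + 1))
  · rw [Set.indicator_of_mem hω]
    split_ifs with hji hi _
    · linarith
    · linarith [H.demand_le_one j i (hji ▸ hg.mem_allowed j hj)]
    · linarith
    · linarith
  · rw [Set.indicator_of_notMem hω, add_zero]
    split_ifs with hji hi _
    · rfl
    · exact absurd (hji ▸ hg.mem_offered j hj hω) hi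
    · exact hd
    · rfl

lemma sum_charge_le (hg : H.IsRounding K ω g) (hK : 0 ≤ K) :
    ∑ i ∈ H.clients.image g, H.charge i ≤ H.openCharge K ω + H.missCount K ω := by
  classical
  have hopen : ∑ i ∈ H.clients.image g with ω ∈ openEvent K (H.weight n) i, H.charge i
      ≤ H.openCharge K ω := by
    simp only [openCharge, Set.indicator_apply, ← Finset.sum_filter]
    exact Finset.sum_le_sum_of_subset_of_nonneg
      (Finset.filter_subset_filter _ (Finset.subset_univ _)) fun i _ _ => (H.charge_pos i).le
  have hmiss : ∑ i ∈ H.clients.image g with ω ∉ openEvent K (H.weight n) i, H.charge i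
      ≤ H.missCount K ω := by
    set M := H.clients.filter fun j => ω ∈ missEvent K (H.offered j) (H.weight (j + 1)) with hM
    have hsub : (H.clients.image g).filter (fun i => ω ∉ openEvent K (H.weight n) i)
        ⊆ M.image g := by
      intro i hi
      obtain ⟨hig, hiω⟩ := Finset.mem_filter.1 hi
      obtain ⟨j, hj, rfl⟩ := Finset.mem_image.1 hig
      refine Finset.mem_image_of_mem g (Finset.mem_filter.2 ⟨hj, ?_⟩)
      by_contra hω
      exact hiω ((hg.mem_openEvent j hj hω).trans
        (mul_le_mul_of_nonneg_left (H.weight_mono j.2 le_rfl _) hK))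
    calc _ ≤ ∑ i ∈ M.image g, H.charge i :=
          Finset.sum_le_sum_of_subset_of_nonneg hsub fun i _ _ => (H.charge_pos i).le
      _ ≤ ∑ j ∈ M, H.charge (g j) := Finset.sum_image_le_of_nonneg fun i _ => (H.charge_pos i).le
      _ ≤ ∑ j ∈ M, 1 := Finset.sum_le_sum fun j _ => H.charge_le_one (g j)
      _ = H.missCount K ω := by
          simp only [missCount, Set.indicator_apply, ← Finset.sum_filter, hM]
  rw [← Finset.sum_filter_add_sum_filter_not _ fun i => ω ∈ openEvent K (H.weight n) i]
  exact add_le_add hopen hmiss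

lemma sum_assignCost_le (hg : H.IsRounding K ω g) :
    ∑ j ∈ H.clients, H.assignCost j (g j) ≤ H.openAssignCost K ω + H.missCount K ω := by
  rw [openAssignCost, missCount, Finset.sum_sigma, ← Finset.sum_add_distrib]
  refine Finset.sum_le_sum fun j hj => ?_
  have hnonneg : ∀ i ∈ H.offered j, 0 ≤ (openEvent K (H.weight (j + 1)) i).indicator
      (fun _ => H.assignCost j i) ω :=
    fun i _ => Set.indicator_nonneg (fun _ _ => H.assignCost_nonneg j i) _
  by_cases hω : ω ∈ missEvent K (H.offered j) (H.weight (j + 1))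
  · rw [Set.indicator_of_mem hω]
    linarith [Finset.sum_nonneg hnonneg, H.assignCost_le_one j (g j) (hg.mem_allowed j hj)]
  · rw [Set.indicator_of_notMem hω, add_zero]
    refine le_of_eq_of_le ?_ (Finset.single_le_sum hnonneg (hg.mem_offered j hj hω))
    rw [Set.indicator_of_mem (hg.mem_openEvent j hj hω)]

end IsRounding

lemma integrable_missCount : Integrable (H.missCount K) (thresholdMeasure ι) :=
  integrable_sum_indicator_const _ fun _ => measurableSet_missEvent _

lemma integrable_openCharge : Integrable (H.openCharge K) (thresholdMeasure ι) :=
  integrable_sum_indicator_const _ fun _ => measurableSet_openEvent _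

lemma integrable_openAssignCost : Integrable (H.openAssignCost K) (thresholdMeasure ι) :=
  integrable_sum_indicator_const _ fun _ => measurableSet_openEvent _

lemma integrable_roundingBound : Integrable (H.roundingBound K) (thresholdMeasure ι) :=
  (((integrable_const _).add integrable_openCharge).add integrable_openAssignCost).add
    (integrable_missCount.const_mul 3)

lemma integral_missCount_le (hK : 0 ≤ K) :
    ∫ ω, H.missCount K ω ∂thresholdMeasure ι ≤ n * Real.exp (-K) := by
  unfold missCount
  rw [integral_sum_indicator_const _ fun _ => measurableSet_missEvent _]
  simp only [mul_one]
  calc ∑ j ∈ H.clients,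
        (thresholdMeasure ι).real (missEvent K (H.offered j) (H.weight (j + 1)))
      ≤ ∑ _j ∈ H.clients, Real.exp (-K) :=
        Finset.sum_le_sum fun j hj => measureReal_missEvent_le hK (H.step j hj).cover
    _ ≤ n * Real.exp (-K) := by
        rw [Finset.sum_const, nsmul_eq_mul]
        gcongr
        exact (Finset.card_le_univ _).trans_eq (Fintype.card_fin n)

lemma integral_openCharge_le (hK : 1 ≤ K) :
    ∫ ω, H.openCharge K ω ∂thresholdMeasure ι
      ≤ K * (16 + 20 * Real.log (Fintype.card ι)) := by
  unfold openCharge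
  rw [integral_sum_indicator_const _ fun _ => measurableSet_openEvent _]
  calc ∑ i, (thresholdMeasure ι).real (openEvent K (H.weight n) i) * H.charge i
      ≤ ∑ i, K * (H.charge i * H.weight n i) := by
        refine Finset.sum_le_sum fun i _ => ?_
        have hc := H.charge_pos i
        calc _ ≤ K * min 1 (H.weight n i) * H.charge i := by
              gcongr
              exact measureReal_openEvent_le hK (H.weight_pos le_rfl i).le
          _ ≤ K * H.weight n i * H.charge i := by
              gcongr
              exact min_le_right _ _
          _ = K * (H.charge i * H.weight n i) := by ring
    _ ≤ K * (16 + 20 * Real.log (Fintype.card ι)) := by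
        rw [← Finset.mul_sum]
        gcongr
        exact H.sum_charge_mul_weight_le

lemma integral_openAssignCost_le (hK : 1 ≤ K) :
    ∫ ω, H.openAssignCost K ω ∂thresholdMeasure ι
      ≤ K * (12 + 16 * Real.log (Fintype.card ι)) := by
  unfold openAssignCost
  rw [integral_sum_indicator_const _ fun _ => measurableSet_openEvent _, Finset.sum_sigma]
  calc ∑ j ∈ H.clients, ∑ i ∈ H.offered j,
        (thresholdMeasure ι).real (openEvent K (H.weight (j + 1)) i) * H.assignCost j i
      ≤ ∑ j ∈ H.clients, ∑ i ∈ H.offered j,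
          K * (H.assignCost j i * min 1 (H.weight (j + 1) i)) := by
        refine Finset.sum_le_sum fun j _ => Finset.sum_le_sum fun i _ => ?_
        refine (mul_le_mul_of_nonneg_right (measureReal_openEvent_le hK
          (H.weight_pos j.2 i).le) (H.assignCost_nonneg j i)).trans_eq ?_
        ring
    _ ≤ ∑ j ∈ H.clients, K * (4 * H.price j) := by
        refine Finset.sum_le_sum fun j hj => ?_
        rw [← Finset.mul_sum]
        gcongr
        exact (H.step j hj).assign
    _ ≤ K * (12 + 16 * Real.log (Fintype.card ι)) := by
        rw [← Finset.mul_sum, ← Finset.mul_sum]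
        gcongr
        linarith [H.sum_price_le]

theorem integral_roundingBound_le (hK : 1 ≤ K) (hn : n * Real.exp (-K) ≤ 1) :
    ∫ ω, H.roundingBound K ω ∂thresholdMeasure ι
      ≤ 256 * ((1 + Real.log (Fintype.card ι)) * K) := by
  have heq : ∫ ω, H.roundingBound K ω ∂thresholdMeasure ι
      = 160 + 220 * Real.log (Fintype.card ι) + ∫ ω, H.openCharge K ω ∂thresholdMeasure ι
        + ∫ ω, H.openAssignCost K ω ∂thresholdMeasure ι
        + 3 * ∫ ω, H.missCount K ω ∂thresholdMeasure ι := by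
    unfold roundingBound
    have hcharge : Integrable (fun ω => 160 + 220 * Real.log (Fintype.card ι)
        + H.openCharge K ω) (thresholdMeasure ι) :=
      (integrable_const _).add integrable_openCharge
    have hassign : Integrable (fun ω => 160 + 220 * Real.log (Fintype.card ι)
        + H.openCharge K ω + H.openAssignCost K ω) (thresholdMeasure ι) :=
      hcharge.add integrable_openAssignCost
    rw [integral_add hassign (integrable_missCount.const_mul 3),
      integral_add hcharge integrable_openAssignCost,
      integral_add (integrable_const _) integrable_openCharge, integral_const, probReal_univ,
      one_smul, integral_const_mul]
  have hlog := Real.log_natCast_nonneg (Fintype.card ι)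
  have hmiss := integral_missCount_le (H := H) (zero_le_one.trans hK)
  have hcharge := integral_openCharge_le (H := H) hK
  have hassign := integral_openAssignCost_le (H := H) hK
  nlinarith [mul_le_mul_of_nonneg_right hK hlog]

end FractionalRun

lemma ccflCost_congr {m n : ℕ} {c u : Fin m → ℝ} {σ τ : Fin n → Client m}
    {J : Finset (Fin n)} (hJ : ∀ k ∈ J, σ k = τ k) (O : Finset (Fin m)) (f : Fin n → Fin m) :
    ccflCost c u σ J O f = ccflCost c u τ J O f := by
  have hload (i : Fin m) : ∑ j ∈ J with f j = i, (σ j).demand i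
      = ∑ j ∈ J with f j = i, (τ j).demand i :=
    Finset.sum_congr rfl fun k hk => by rw [hJ k (Finset.mem_filter.1 hk).1]
  have hassign : ∑ j ∈ J, (σ j).assignCost (f j) = ∑ j ∈ J, (τ j).assignCost (f j) :=
    Finset.sum_congr rfl fun k hk => by rw [hJ k hk]
  simp only [ccflCost, hload, hassign]

section Algorithm

variable {m n : ℕ} [NeZero n] (c u : Fin m → ℝ)

/-- The parameter `Z` in force in epoch `k`. -/
noncomputable def epochZ (σ : Fin n → Client m) (k : ℕ) : ℝ :=
  2 ^ k * ⨅ i, ccflSingle c u σ 0 i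

/-- The first epoch whose parameter is at least the least cost of serving the clients up to `j`. -/
noncomputable def earliestEpoch (σ : Fin n → Client m) (j : Fin n) : ℕ :=
  sInf {k | ∃ f : Fin n → Fin m,
    ccflCost c u σ (Finset.Iic j) ((Finset.Iic j).image f) f ≤ epochZ c u σ k}

/-- The epoch of client `j`. The supremum makes it monotone in `j` even if the clients reveal
negative costs. -/
noncomputable def ccflEpoch (σ : Fin n → Client m) (j : Fin n) : ℕ :=
  (Finset.Iic j).sup (earliestEpoch c u σ)

/-- The clients of epoch `k`. -/
noncomputable def epochClients (σ : Fin n → Client m) (k : ℕ) : Finset (Fin n) :=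
  {j | ccflEpoch c u σ j = k}

/-- Fixed charges in units of `Z`, truncated to `[1 / m, 1]`. -/
noncomputable def normalizedCharge (Z : ℝ) (i : Fin m) : ℝ :=
  max (min (c i / Z) 1) (m : ℝ)⁻¹

/-- The facilities that can serve a client alone at a cost of at most `Z`. -/
noncomputable def affordable (Z : ℝ) (r : Client m) : Finset (Fin m) :=
  {i | c i + r.demand i / u i + r.assignCost i ≤ Z}

/-- One step of the fractional algorithm on a client with data `r`: the new weights, the offered
facilities and the price. It is arbitrary on inputs for which no such step exists. -/
noncomputable def ccflStep (Z : ℝ) (r : Client m) (y : Fin m → ℝ) :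
    (Fin m → ℝ) × Finset (Fin m) × ℝ :=
  Classical.epsilon fun s => IsFractionalStep (normalizedCharge c Z) (r.assignCost · / Z)
    (fun i => r.demand i / u i / Z) (affordable c u Z r) y s.1 s.2.1 s.2.2

/-- The weights of epoch `k` after the first `t` clients. -/
noncomputable def ccflWeight (σ : Fin n → Client m) (k : ℕ) : ℕ → Fin m → ℝ
  | 0 => fun _ => (m : ℝ)⁻¹
  | t + 1 =>
    if h : ∃ ht : t < n, ccflEpoch c u σ ⟨t, ht⟩ = k then
      (ccflStep c u (epochZ c u σ k) (σ ⟨t, h.fst⟩) (ccflWeight σ k t)).1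
    else ccflWeight σ k t

/-- The step of the fractional algorithm that client `j` triggers in its epoch. -/
noncomputable def clientStep (σ : Fin n → Client m) (j : Fin n) :
    (Fin m → ℝ) × Finset (Fin m) × ℝ :=
  ccflStep c u (epochZ c u σ (ccflEpoch c u σ j)) (σ j)
    (ccflWeight c u σ (ccflEpoch c u σ j) j)

/-- The factor by which weights are scaled up before they are compared with the thresholds; it makes
the expected number of missed clients at most one. -/
noncomputable def thresholdScale (m n : ℕ) : ℝ :=
  1 + Real.log (m * n)

open Classical in
/-- The facilities offered to client `j` that are open for it. -/
noncomputable def ready (ω : Fin m → ℝ) (σ : Fin n → Client m) (j : Fin n) : Finset (Fin m) :=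
  {i ∈ (clientStep c u σ j).2.1 | ω ∈ openEvent (thresholdScale m n) (clientStep c u σ j).1 i}

/-- The facility to which client `j` is assigned: a ready one if possible, else an affordable
one. -/
noncomputable def ccflTarget [NeZero m] (ω : Fin m → ℝ) (σ : Fin n → Client m) (j : Fin n) :
    Fin m :=
  Classical.epsilon (· ∈ if (ready c u ω σ j).Nonempty then ready c u ω σ j
    else affordable c u (epochZ c u σ (ccflEpoch c u σ j)) (σ j))

variable {c u}

lemma normalizedCharge_le_one (Z : ℝ) (i : Fin m) : normalizedCharge c Z i ≤ 1 :=
  max_le (min_le_right _ _) (Nat.cast_inv_le_one m)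

lemma le_mul_normalizedCharge {Z : ℝ} (hZ : 0 < Z) {i : Fin m} (hi : c i ≤ Z) :
    c i ≤ Z * normalizedCharge c Z i := by
  rw [← div_le_iff₀' hZ]
  exact (le_min le_rfl ((div_le_one hZ).2 hi)).trans (le_max_left _ _)

lemma normalizedCharge_pos [NeZero m] (Z : ℝ) (i : Fin m) : 0 < normalizedCharge c Z i :=
  lt_max_of_lt_right (inv_pos.2 (Nat.cast_pos.2 (NeZero.pos m)))

section Decision

variable {σ τ : Fin n → Client m} {j : Fin n}

lemma ccflWeight_succ_of_mem {k : ℕ} (hj : j ∈ epochClients c u σ k) :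
    ccflWeight c u σ k (j + 1) = (clientStep c u σ j).1 := by
  obtain rfl := (Finset.mem_filter.1 hj).2
  rw [ccflWeight, dif_pos ⟨j.2, rfl⟩, clientStep]

lemma ccflWeight_succ_of_notMem {k : ℕ} (hj : j ∉ epochClients c u σ k) :
    ccflWeight c u σ k (j + 1) = ccflWeight c u σ k j := by
  rw [ccflWeight, dif_neg]
  rintro ⟨_, hk⟩
  exact hj (Finset.mem_filter.2 ⟨Finset.mem_univ _, hk⟩)

lemma mem_ready {ω : Fin m → ℝ} {i : Fin m} : i ∈ ready c u ω σ j ↔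
    i ∈ (clientStep c u σ j).2.1 ∧
      ω ∈ openEvent (thresholdScale m n) (clientStep c u σ j).1 i := by
  simp only [ready, Finset.mem_filter]

lemma ready_nonempty_of_notMem_missEvent {ω : Fin m → ℝ}
    (hω : ω ∉ missEvent (thresholdScale m n) (clientStep c u σ j).2.1 (clientStep c u σ j).1) :
    (ready c u ω σ j).Nonempty := by
  simp only [missEvent, Set.mem_ofPred_eq, not_forall, not_not] at hω
  obtain ⟨i, hi, hiω⟩ := hω
  exact ⟨i, mem_ready.2 ⟨hi, hiω⟩⟩

lemma ccflTarget_mem_ready [NeZero m] {ω : Fin m → ℝ} (hne : (ready c u ω σ j).Nonempty) :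
    ccflTarget c u ω σ j ∈ ready c u ω σ j := by
  rw [ccflTarget, if_pos hne]
  exact Classical.epsilon_spec hne

lemma epochZ_congr (h : σ 0 = τ 0) : epochZ c u σ = epochZ c u τ := by
  unfold epochZ ccflSingle
  rw [h]

lemma earliestEpoch_congr (h : ∀ k ≤ j, σ k = τ k) :
    earliestEpoch c u σ j = earliestEpoch c u τ j := by
  simp only [earliestEpoch, epochZ_congr (h 0 (Fin.zero_le j)),
    ccflCost_congr fun k hk => h k (Finset.mem_Iic.1 hk)]

lemma ccflEpoch_congr (h : ∀ k ≤ j, σ k = τ k) : ccflEpoch c u σ j = ccflEpoch c u τ j :=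
  Finset.sup_congr rfl fun _ hk =>
    earliestEpoch_congr fun l hl => h l (hl.trans (Finset.mem_Iic.1 hk))

lemma ccflWeight_congr (k : ℕ) {t : ℕ} (h : ∀ l : Fin n, l.1 < t → σ l = τ l) :
    ccflWeight c u σ k t = ccflWeight c u τ k t := by
  induction t with
  | zero => rfl
  | succ t ih =>
    have hweight := ih fun l hl => h l (by omega)
    by_cases ht : t < n
    · have hle : ∀ l ≤ (⟨t, ht⟩ : Fin n), σ l = τ l := fun l hl => h l (Nat.lt_succ_of_le hl)
      simp only [ccflWeight, ht, exists_true_left, ccflEpoch_congr hle, hle _ le_rfl, hweight,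
        epochZ_congr (hle 0 (Fin.zero_le _))]
    · simp only [ccflWeight, ht, IsEmpty.exists_iff, dite_false, hweight]

lemma clientStep_congr (h : ∀ k ≤ j, σ k = τ k) : clientStep c u σ j = clientStep c u τ j := by
  rw [clientStep, clientStep, ccflEpoch_congr h, h j le_rfl, epochZ_congr (h 0 (Fin.zero_le j)),
    ccflWeight_congr _ fun l hl => h l (le_of_lt hl)]

lemma ready_congr (ω : Fin m → ℝ) (h : ∀ k ≤ j, σ k = τ k) :
    ready c u ω σ j = ready c u ω τ j := by
  unfold ready
  rw [clientStep_congr h]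

lemma ccflTarget_congr [NeZero m] (ω : Fin m → ℝ) (h : ∀ k ≤ j, σ k = τ k) :
    ccflTarget c u ω σ j = ccflTarget c u ω τ j := by
  simp only [ccflTarget, ready_congr ω h, ccflEpoch_congr h,
    epochZ_congr (h 0 (Fin.zero_le j)), h j le_rfl]

end Decision

lemma measurableSet_ready (σ : Fin n → Client m) (j : Fin n) (s : Finset (Fin m)) :
    MeasurableSet {ω | ready c u ω σ j = s} := by
  have hfiber : {ω | ready c u ω σ j = s} = ⋂ i, {ω | i ∈ ready c u ω σ j ↔ i ∈ s} := by
    ext ω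
    simp only [Finset.ext_iff, Set.mem_ofPred_eq, Set.mem_iInter]
  rw [hfiber]
  refine MeasurableSet.iInter fun i => MeasurableSet.iff ?_ (MeasurableSet.const _)
  simp only [mem_ready]
  exact (MeasurableSet.const _).inter (measurableSet_openEvent i)

lemma measurableSet_ccflTarget [NeZero m] (σ : Fin n → Client m) (j : Fin n) (S : Set (Fin m)) :
    MeasurableSet {ω | ccflTarget c u ω σ j ∈ S} := by
  have hunion : {ω | ccflTarget c u ω σ j ∈ S}
      = ⋃ s ∈ {s : Finset (Fin m) | Classical.epsilon (· ∈ if s.Nonempty then s else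
          affordable c u (epochZ c u σ (ccflEpoch c u σ j)) (σ j)) ∈ S},
        {ω | ready c u ω σ j = s} := by
    ext ω
    simp only [ccflTarget, Set.mem_ofPred_eq, Set.mem_iUnion, exists_prop, exists_eq_right']
  rw [hunion]
  exact MeasurableSet.biUnion (Set.to_countable _) fun s _ => measurableSet_ready σ j s

variable (c u) in
/-- The online algorithm for capacity-constrained facility location: the fractional algorithm is
restarted in every epoch and rounded by one threshold per facility. -/
noncomputable def ccflAlgorithm [NeZero m] : EpochAlgorithm (Client m) m n where
  Ω := Fin m → ℝ
  μ := thresholdMeasure (Fin m)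
  epoch := ccflEpoch c u
  newOpen ω σ j := {ccflTarget c u ω σ j}
  target := ccflTarget c u
  epoch_online _ _ _ h := ccflEpoch_congr h
  newOpen_online ω _ _ _ h := by rw [ccflTarget_congr ω h]
  target_online ω _ _ _ h := ccflTarget_congr ω h
  epoch_monotone _ _ _ h := Finset.sup_mono (Finset.Iic_subset_Iic.2 h)
  target_open _ _ j := ⟨j, le_rfl, rfl, Finset.mem_singleton_self _⟩
  measurableSet_newOpen σ j s := measurableSet_ccflTarget σ j {i | {i} = s}
  measurableSet_target σ j i := measurableSet_ccflTarget σ j {i}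

end Algorithm

lemma mem_affordable {m n : ℕ} {c u : Fin m → ℝ} {σ : Fin n → Client m} {Z : ℝ} {j : Fin n}
    {i : Fin m} : i ∈ affordable c u Z (σ j) ↔ ccflSingle c u σ j i ≤ Z := by
  simp only [affordable, ccflSingle, Finset.mem_filter_univ]

section ValidInput

variable {m n : ℕ} [NeZero n]

/-- An instance of capacity-constrained facility location in which every way of serving the first
client alone has positive cost. -/
structure ValidInput (c u : Fin m → ℝ) (σ : Fin n → Client m) : Prop where
  charge_nonneg : ∀ i, 0 ≤ c i
  capacity_pos : ∀ i, 0 < u i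
  demand_nonneg : ∀ j i, 0 ≤ (σ j).demand i
  assignCost_nonneg : ∀ j i, 0 ≤ (σ j).assignCost i
  single_zero_pos : ∀ i, 0 < ccflSingle c u σ 0 i

namespace ValidInput

variable {c u : Fin m → ℝ} {σ : Fin n → Client m}

section Cost

variable (J : Finset (Fin n)) (O : Finset (Fin m)) (f : Fin n → Fin m)

lemma iSup_congestion_nonneg (H : ValidInput c u σ) :
    0 ≤ ⨆ i, (∑ j ∈ J with f j = i, (σ j).demand i) / u i :=
  Real.iSup_nonneg fun i =>
    div_nonneg (Finset.sum_nonneg fun j _ => H.demand_nonneg j i) (H.capacity_pos i).le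

lemma sum_charge_nonneg (H : ValidInput c u σ) : 0 ≤ ∑ i ∈ O, c i :=
  Finset.sum_nonneg fun i _ => H.charge_nonneg i

lemma sum_assignCost_nonneg (H : ValidInput c u σ) : 0 ≤ ∑ j ∈ J, (σ j).assignCost (f j) :=
  Finset.sum_nonneg fun j _ => H.assignCost_nonneg j _

lemma ccflCost_nonneg (H : ValidInput c u σ) : 0 ≤ ccflCost c u σ J O f :=
  add_nonneg (add_nonneg (H.iSup_congestion_nonneg J f) (H.sum_charge_nonneg O))
    (H.sum_assignCost_nonneg J f)

lemma congestion_le_ccflCost (H : ValidInput c u σ) (i : Fin m) :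
    (∑ j ∈ J with f j = i, (σ j).demand i) / u i ≤ ccflCost c u σ J O f :=
  calc (∑ j ∈ J with f j = i, (σ j).demand i) / u i
      ≤ ⨆ i, (∑ j ∈ J with f j = i, (σ j).demand i) / u i :=
        le_ciSup (f := fun i => (∑ j ∈ J with f j = i, (σ j).demand i) / u i)
          (Set.finite_range _).bddAbove i
    _ ≤ ccflCost c u σ J O f := by
        unfold ccflCost
        linarith [H.sum_charge_nonneg O, H.sum_assignCost_nonneg J f]

lemma sum_charge_le_ccflCost (H : ValidInput c u σ) : ∑ i ∈ O, c i ≤ ccflCost c u σ J O f := by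
  unfold ccflCost
  linarith [H.iSup_congestion_nonneg J f, H.sum_assignCost_nonneg J f]

lemma sum_assignCost_le_ccflCost (H : ValidInput c u σ) :
    ∑ j ∈ J, (σ j).assignCost (f j) ≤ ccflCost c u σ J O f := by
  unfold ccflCost
  linarith [H.iSup_congestion_nonneg J f, H.sum_charge_nonneg O]

variable {J O f}

lemma ccflCost_mono (H : ValidInput c u σ) {J' : Finset (Fin n)} (hJ : J ⊆ J')
    {O' : Finset (Fin m)} (hO : O ⊆ O') :
    ccflCost c u σ J O f ≤ ccflCost c u σ J' O' f := by
  refine add_le_add (add_le_add ?_ ?_) ?_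
  · refine ciSup_mono (Set.finite_range _).bddAbove fun i => ?_
    exact div_le_div_of_nonneg_right (Finset.sum_le_sum_of_subset_of_nonneg
      (Finset.filter_subset_filter _ hJ) fun j _ _ => H.demand_nonneg j i) (H.capacity_pos i).le
  · exact Finset.sum_le_sum_of_subset_of_nonneg hO fun i _ _ => H.charge_nonneg i
  · exact Finset.sum_le_sum_of_subset_of_nonneg hJ fun j _ _ => H.assignCost_nonneg j _

lemma ccflSingle_le_ccflCost (H : ValidInput c u σ) {j : Fin n} (hj : j ∈ J) (hO : f j ∈ O) :
    ccflSingle c u σ j (f j) ≤ ccflCost c u σ J O f := by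
  have hload : (σ j).demand (f j) / u (f j)
      ≤ ⨆ i, (∑ j ∈ J with f j = i, (σ j).demand i) / u i := by
    refine le_trans ?_ (le_ciSup (f := fun i => (∑ j ∈ J with f j = i, (σ j).demand i) / u i)
      (Set.finite_range _).bddAbove (f j))
    exact div_le_div_of_nonneg_right (Finset.single_le_sum (f := fun k => (σ k).demand (f j))
      (fun k _ => H.demand_nonneg k _) (Finset.mem_filter.2 ⟨hj, rfl⟩)) (H.capacity_pos _).le
  have hcharge : c (f j) ≤ ∑ i ∈ O, c i :=
    Finset.single_le_sum (fun i _ => H.charge_nonneg i) hO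
  have hassign : (σ j).assignCost (f j) ≤ ∑ j ∈ J, (σ j).assignCost (f j) :=
    Finset.single_le_sum (f := fun k => (σ k).assignCost (f k))
      (fun k _ => H.assignCost_nonneg k _) hj
  unfold ccflSingle ccflCost
  linarith

lemma ccflOpt_nonneg (H : ValidInput c u σ) : 0 ≤ ccflOpt c u σ :=
  Real.iInf_nonneg fun _ => H.ccflCost_nonneg _ _ _

end Cost

section Parameter

variable [NeZero m]

lemma epochZ_pos (H : ValidInput c u σ) (k : ℕ) : 0 < epochZ c u σ k := by
  obtain ⟨i, hi⟩ := exists_eq_ciInf_of_finite (f := ccflSingle c u σ 0)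
  rw [epochZ, ← hi]
  exact mul_pos (by positivity) (H.single_zero_pos i)

lemma exists_ccflCost_Iic_le (H : ValidInput c u σ) (j : Fin n) :
    ∃ f : Fin n → Fin m, ccflCost c u σ (Finset.Iic j) ((Finset.Iic j).image f) f
      ≤ epochZ c u σ (ccflEpoch c u σ j) := by
  have hz : 0 < ⨅ i, ccflSingle c u σ 0 i := by simpa [epochZ] using H.epochZ_pos 0
  have hne : {k | ∃ f : Fin n → Fin m, ccflCost c u σ (Finset.Iic j) ((Finset.Iic j).image f) f
      ≤ epochZ c u σ k}.Nonempty := by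
    obtain ⟨k, hk⟩ := pow_unbounded_of_one_lt (ccflCost c u σ (Finset.Iic j)
      ((Finset.Iic j).image fun _ => 0) (fun _ => 0) / ⨅ i, ccflSingle c u σ 0 i)
      (one_lt_two (α := ℝ))
    exact ⟨k, fun _ => 0, ((div_lt_iff₀ hz).1 hk).le⟩
  obtain ⟨f, hf⟩ := Nat.sInf_mem hne
  refine ⟨f, hf.trans (mul_le_mul_of_nonneg_right ?_ hz.le)⟩
  exact pow_le_pow_right₀ one_le_two
    (Finset.le_sup (f := earliestEpoch c u σ) (Finset.mem_Iic.2 le_rfl))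

lemma epochZ_ccflEpoch_le (H : ValidInput c u σ) (j : Fin n) :
    epochZ c u σ (ccflEpoch c u σ j) ≤ 2 * ccflOpt c u σ := by
  obtain ⟨k, -, hk⟩ := Finset.exists_mem_eq_sup (Finset.Iic j) ⟨j, Finset.mem_Iic.2 le_rfl⟩
    (earliestEpoch c u σ)
  rw [ccflEpoch, hk]
  rcases hl : earliestEpoch c u σ k with _ | l
  · have hstart : epochZ c u σ 0 ≤ ccflOpt c u σ := by
      refine le_ciInf fun f => ?_
      rw [epochZ, pow_zero, one_mul]
      exact (ciInf_le (Set.finite_range _).bddBelow (f 0)).trans (H.ccflSingle_le_ccflCost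
        (Finset.mem_univ _) (Finset.mem_image_of_mem f (Finset.mem_univ _)))
    linarith [H.ccflOpt_nonneg]
  · have hprev : epochZ c u σ l ≤ ccflOpt c u σ := by
      refine le_ciInf fun f => ?_
      have hnot := Nat.notMem_of_lt_sInf (show l < earliestEpoch c u σ k by omega)
      exact (not_le.1 fun hle => hnot ⟨f, hle⟩).le.trans
        (H.ccflCost_mono (Finset.subset_univ _) (Finset.image_subset_image (Finset.subset_univ _)))
    have hdouble : epochZ c u σ (l + 1) = 2 * epochZ c u σ l := by
      rw [epochZ, epochZ, pow_succ']
      ring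
    linarith

lemma exists_ccflCost_epochClients_le (H : ValidInput c u σ) (k : ℕ) :
    ∃ f : Fin n → Fin m, ccflCost c u σ (epochClients c u σ k)
      ((epochClients c u σ k).image f) f ≤ epochZ c u σ k := by
  rcases (epochClients c u σ k).eq_empty_or_nonempty with hempty | hne
  · refine ⟨fun _ => 0, le_of_eq_of_le ?_ (H.epochZ_pos k).le⟩
    simp [hempty, ccflCost]
  · obtain ⟨f, hf⟩ := H.exists_ccflCost_Iic_le ((epochClients c u σ k).max' hne)
    rw [(Finset.mem_filter.1 ((epochClients c u σ k).max'_mem hne)).2] at hf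
    have hsub : epochClients c u σ k ⊆ Finset.Iic ((epochClients c u σ k).max' hne) :=
      fun j hj => Finset.mem_Iic.2 (Finset.le_max' _ j hj)
    exact ⟨f, (H.ccflCost_mono hsub (Finset.image_subset_image hsub)).trans hf⟩

lemma sum_epochZ_le (H : ValidInput c u σ) :
    ∑ k ∈ (ccflAlgorithm c u).epochs σ, epochZ c u σ k ≤ 4 * ccflOpt c u σ := by
  have hsub : (ccflAlgorithm c u).epochs σ ⊆ Finset.range (ccflEpoch c u σ ⊤ + 1) := by
    intro k hk
    obtain ⟨j, -, rfl⟩ := Finset.mem_image.1 hk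
    exact Finset.mem_range.2 (Nat.lt_succ_of_le ((ccflAlgorithm c u).epoch_monotone σ le_top))
  have hz : 0 ≤ ⨅ i, ccflSingle c u σ 0 i := by simpa [epochZ] using (H.epochZ_pos 0).le
  calc ∑ k ∈ (ccflAlgorithm c u).epochs σ, epochZ c u σ k
      ≤ ∑ k ∈ Finset.range (ccflEpoch c u σ ⊤ + 1), epochZ c u σ k :=
        Finset.sum_le_sum_of_subset_of_nonneg hsub fun k _ _ => (H.epochZ_pos k).le
    _ = (2 ^ (ccflEpoch c u σ ⊤ + 1) - 1) * ⨅ i, ccflSingle c u σ 0 i := by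
        simp only [epochZ]
        rw [← Finset.sum_mul, geom_sum_eq (by norm_num)]
        norm_num
    _ ≤ 2 * epochZ c u σ (ccflEpoch c u σ ⊤) := by
        rw [epochZ, pow_succ]
        linarith
    _ ≤ 4 * ccflOpt c u σ := by linarith [H.epochZ_ccflEpoch_le ⊤]

end Parameter

section Run

lemma charge_le_of_mem_affordable (H : ValidInput c u σ) {Z : ℝ} {j : Fin n} {i : Fin m}
    (hi : i ∈ affordable c u Z (σ j)) : c i ≤ Z := by
  have hsingle := mem_affordable.1 hi
  unfold ccflSingle at hsingle
  linarith [H.assignCost_nonneg j i, div_nonneg (H.demand_nonneg j i) (H.capacity_pos i).le]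

lemma demand_div_le_of_mem_affordable (H : ValidInput c u σ) {Z : ℝ} {j : Fin n} {i : Fin m}
    (hi : i ∈ affordable c u Z (σ j)) : (σ j).demand i / u i ≤ Z := by
  have hsingle := mem_affordable.1 hi
  unfold ccflSingle at hsingle
  linarith [H.charge_nonneg i, H.assignCost_nonneg j i]

lemma assignCost_le_of_mem_affordable (H : ValidInput c u σ) {Z : ℝ} {j : Fin n} {i : Fin m}
    (hi : i ∈ affordable c u Z (σ j)) : (σ j).assignCost i ≤ Z := by
  have hsingle := mem_affordable.1 hi
  unfold ccflSingle at hsingle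
  linarith [H.charge_nonneg i, div_nonneg (H.demand_nonneg j i) (H.capacity_pos i).le]

lemma sum_normalizedCharge_le (H : ValidInput c u σ) {Z : ℝ} (hZ : 0 < Z) {O : Finset (Fin m)}
    (hO : ∑ i ∈ O, c i ≤ Z) : ∑ i ∈ O, normalizedCharge c Z i ≤ 2 := by
  have hsplit (i : Fin m) : normalizedCharge c Z i ≤ c i / Z + (m : ℝ)⁻¹ :=
    (max_le_add_of_nonneg (le_min (div_nonneg (H.charge_nonneg i) hZ.le) zero_le_one)
      (by positivity)).trans (add_le_add_left (min_le_left _ _) _)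
  have hcard : (O.card : ℝ) ≤ m := by
    exact_mod_cast (Finset.card_le_univ O).trans_eq (Fintype.card_fin m)
  calc ∑ i ∈ O, normalizedCharge c Z i ≤ ∑ i ∈ O, (c i / Z + (m : ℝ)⁻¹) :=
        Finset.sum_le_sum fun i _ => hsplit i
    _ = (∑ i ∈ O, c i) / Z + O.card / m := by
        rw [Finset.sum_add_distrib, Finset.sum_div, Finset.sum_const, nsmul_eq_mul,
          div_eq_mul_inv (O.card : ℝ)]
    _ ≤ 1 + 1 := add_le_add ((div_le_one hZ).2 hO)
        (div_le_one_of_le₀ hcard (Nat.cast_nonneg m))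
    _ = 2 := by norm_num

variable [NeZero m]

lemma affordable_nonempty (H : ValidInput c u σ) (j : Fin n) :
    (affordable c u (epochZ c u σ (ccflEpoch c u σ j)) (σ j)).Nonempty := by
  obtain ⟨f, hf⟩ := H.exists_ccflCost_Iic_le j
  have hj := Finset.mem_Iic.2 (le_refl j)
  exact ⟨f j, mem_affordable.2
    ((H.ccflSingle_le_ccflCost hj (Finset.mem_image_of_mem f hj)).trans hf)⟩

lemma isFractionalStep_ccflStep (H : ValidInput c u σ) (j : Fin n) {y : Fin m → ℝ}
    (hy : ∀ i, 0 < y i) {k : ℕ} (hj : j ∈ epochClients c u σ k) :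
    IsFractionalStep (normalizedCharge c (epochZ c u σ k))
      (fun i => (σ j).assignCost i / epochZ c u σ k)
      (fun i => (σ j).demand i / u i / epochZ c u σ k) (affordable c u (epochZ c u σ k) (σ j)) y
      (ccflStep c u (epochZ c u σ k) (σ j) y).1 (ccflStep c u (epochZ c u σ k) (σ j) y).2.1
      (ccflStep c u (epochZ c u σ k) (σ j) y).2.2 := by
  obtain rfl := (Finset.mem_filter.1 hj).2
  have hZ := H.epochZ_pos (ccflEpoch c u σ j)
  obtain ⟨y', E, τ, hstep⟩ := exists_isFractionalStep (H.affordable_nonempty j)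
    (normalizedCharge_pos (c := c) (epochZ c u σ (ccflEpoch c u σ j))) hy
    (a := fun i => (σ j).assignCost i / epochZ c u σ (ccflEpoch c u σ j))
    (p := fun i => (σ j).demand i / u i / epochZ c u σ (ccflEpoch c u σ j))
    (fun i _ => div_nonneg (H.assignCost_nonneg j i) hZ.le)
    (fun i _ => div_nonneg (div_nonneg (H.demand_nonneg j i) (H.capacity_pos i).le) hZ.le)
    (fun i hi => (div_le_one hZ).2 (H.demand_div_le_of_mem_affordable hi))
  exact Classical.epsilon_spec (p := fun s : (Fin m → ℝ) × Finset (Fin m) × ℝ =>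
    IsFractionalStep _ _ _ _ y s.1 s.2.1 s.2.2) ⟨(y', E, τ), hstep⟩

lemma ccflWeight_pos (H : ValidInput c u σ) (k t : ℕ) (i : Fin m) :
    0 < ccflWeight c u σ k t i := by
  induction t generalizing i with
  | zero => exact inv_pos.2 (Nat.cast_pos.2 (NeZero.pos m))
  | succ t ih =>
    rw [ccflWeight]
    split_ifs with hk
    · exact (ih i).trans_le ((H.isFractionalStep_ccflStep ⟨t, hk.fst⟩ ih
        (Finset.mem_filter.2 ⟨Finset.mem_univ _, hk.snd⟩)).le_next i)
    · exact ih i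

/-- Epoch `k` as a run of the fractional algorithm in units of `Z`; its benchmark is an assignment
of the clients of the epoch of total cost at most `Z`. -/
noncomputable def fractionalRun (H : ValidInput c u σ) (k : ℕ) : FractionalRun (Fin m) n where
  charge := normalizedCharge c (epochZ c u σ k)
  assignCost j i := (σ j).assignCost i / epochZ c u σ k
  demand j i := (σ j).demand i / u i / epochZ c u σ k
  clients := epochClients c u σ k
  allowed j := affordable c u (epochZ c u σ k) (σ j)
  offered j := (clientStep c u σ j).2.1
  weight := ccflWeight c u σ k
  price j := (clientStep c u σ j).2.2
  benchmark := (H.exists_ccflCost_epochClients_le k).choose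
  inv_card_le_charge i := by
    rw [Fintype.card_fin]
    exact le_max_right _ _
  charge_le_one := normalizedCharge_le_one _
  demand_nonneg j i :=
    div_nonneg (div_nonneg (H.demand_nonneg j i) (H.capacity_pos i).le) (H.epochZ_pos k).le
  demand_le_one j i hi := (div_le_one (H.epochZ_pos k)).2 (H.demand_div_le_of_mem_affordable hi)
  assignCost_nonneg j i := div_nonneg (H.assignCost_nonneg j i) (H.epochZ_pos k).le
  assignCost_le_one j i hi :=
    (div_le_one (H.epochZ_pos k)).2 (H.assignCost_le_of_mem_affordable hi)
  weight_zero i := by rw [Fintype.card_fin, ccflWeight]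
  step j hj := by
    have hstep := H.isFractionalStep_ccflStep j (H.ccflWeight_pos k j) hj
    rw [ccflWeight_succ_of_mem hj]
    obtain rfl := (Finset.mem_filter.1 hj).2
    exact hstep
  stay j hj := ccflWeight_succ_of_notMem hj
  benchmark_mem j hj := mem_affordable.2 ((H.ccflSingle_le_ccflCost hj
    (Finset.mem_image_of_mem _ hj)).trans (H.exists_ccflCost_epochClients_le k).choose_spec)
  benchmark_load i := by
    rw [← Finset.sum_div, ← Finset.sum_div, div_le_one (H.epochZ_pos k)]
    exact (H.congestion_le_ccflCost _ _ _ i).trans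
      (H.exists_ccflCost_epochClients_le k).choose_spec
  benchmark_assignCost := by
    rw [← Finset.sum_div, div_le_one (H.epochZ_pos k)]
    exact (H.sum_assignCost_le_ccflCost _ _ _).trans
      (H.exists_ccflCost_epochClients_le k).choose_spec
  benchmark_charge := H.sum_normalizedCharge_le (H.epochZ_pos k)
    ((H.sum_charge_le_ccflCost _ _ _).trans (H.exists_ccflCost_epochClients_le k).choose_spec)

lemma ccflTarget_mem_affordable (H : ValidInput c u σ) (ω : Fin m → ℝ) (j : Fin n) :
    ccflTarget c u ω σ j ∈ affordable c u (epochZ c u σ (ccflEpoch c u σ j)) (σ j) := by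
  by_cases hne : (ready c u ω σ j).Nonempty
  · exact ((H.fractionalRun (ccflEpoch c u σ j)).step j (Finset.mem_filter.2
      ⟨Finset.mem_univ _, rfl⟩)).subset (mem_ready.1 (ccflTarget_mem_ready hne)).1
  · rw [ccflTarget, if_neg hne]
    exact Classical.epsilon_spec (H.affordable_nonempty j)

lemma isRounding_ccflTarget (H : ValidInput c u σ) (k : ℕ) (ω : Fin m → ℝ) :
    (H.fractionalRun k).IsRounding (thresholdScale m n) ω (ccflTarget c u ω σ) where
  mem_allowed j hj := (Finset.mem_filter.1 hj).2 ▸ H.ccflTarget_mem_affordable ω j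
  mem_offered j hj hω := by
    have hweight : (H.fractionalRun k).weight (j + 1) = _ := ccflWeight_succ_of_mem hj
    rw [hweight] at hω
    exact (mem_ready.1 (ccflTarget_mem_ready (ready_nonempty_of_notMem_missEvent hω))).1
  mem_openEvent j hj hω := by
    have hweight : (H.fractionalRun k).weight (j + 1) = _ := ccflWeight_succ_of_mem hj
    rw [hweight] at hω ⊢
    exact (mem_ready.1 (ccflTarget_mem_ready (ready_nonempty_of_notMem_missEvent hω))).2

end Run

end ValidInput

end ValidInput

section ThresholdScale

variable (m n : ℕ)

lemma one_le_thresholdScale : 1 ≤ thresholdScale m n := by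
  rw [thresholdScale, ← Nat.cast_mul]
  linarith [Real.log_natCast_nonneg (m * n)]

lemma mul_exp_neg_thresholdScale_le_one [NeZero m] [NeZero n] :
    n * Real.exp (-thresholdScale m n) ≤ 1 := by
  have hm : (1 : ℝ) ≤ m := Nat.one_le_cast.2 (NeZero.pos m)
  have hn : (0 : ℝ) < n := Nat.cast_pos.2 (NeZero.pos n)
  have hlog : Real.log n ≤ thresholdScale m n := by
    rw [thresholdScale]
    linarith [Real.log_le_log hn (le_mul_of_one_le_left hn.le hm)]
  rw [Real.exp_neg, mul_inv_le_iff₀ (Real.exp_pos _), one_mul]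
  exact (Real.log_le_iff_le_exp hn).1 hlog

end ThresholdScale

namespace ValidInput

variable {m n : ℕ} [NeZero n] {c u : Fin m → ℝ} {σ : Fin n → Client m}

lemma ccflCost_opened_le_sum_epochs (H : ValidInput c u σ) (A : EpochAlgorithm (Client m) m n)
    (ω : A.Ω) :
    ccflCost c u σ Finset.univ (A.opened ω σ) (A.target ω σ)
      ≤ ∑ k ∈ A.epochs σ, ccflCost c u σ (A.served σ k) (A.openedIn ω σ k) (A.target ω σ) := by
  have hepoch : ∀ j ∈ (Finset.univ : Finset (Fin n)), A.epoch σ j ∈ A.epochs σ := fun j hj =>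
    Finset.mem_image_of_mem _ hj
  have hcongestion (i : Fin m) : (∑ j with A.target ω σ j = i, (σ j).demand i) / u i
      = ∑ k ∈ A.epochs σ, (∑ j ∈ A.served σ k with A.target ω σ j = i, (σ j).demand i) / u i := by
    rw [← Finset.sum_div, Finset.sum_filter, ← Finset.sum_fiberwise_of_maps_to hepoch]
    simp only [Finset.sum_filter, EpochAlgorithm.served]
  have hopened : A.opened ω σ ⊆ (A.epochs σ).biUnion (A.openedIn ω σ) := fun i hi => by
    obtain ⟨j, hj, hij⟩ := Finset.mem_biUnion.1 hi
    exact Finset.mem_biUnion.2 ⟨A.epoch σ j, hepoch j hj, Finset.mem_biUnion.2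
      ⟨j, Finset.mem_filter.2 ⟨hj, rfl⟩, hij⟩⟩
  simp only [ccflCost, Finset.sum_add_distrib]
  refine add_le_add (add_le_add ?_ ?_) ?_
  · refine Real.iSup_le (fun i => (hcongestion i).trans_le (Finset.sum_le_sum fun k _ =>
      le_ciSup (f := fun i => (∑ j ∈ A.served σ k with A.target ω σ j = i, (σ j).demand i) / u i)
        (Set.finite_range _).bddAbove i)) ?_
    exact Finset.sum_nonneg fun k _ => H.iSup_congestion_nonneg _ _
  · calc ∑ i ∈ A.opened ω σ, c i ≤ ∑ i ∈ (A.epochs σ).biUnion (A.openedIn ω σ), c i :=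
          Finset.sum_le_sum_of_subset_of_nonneg hopened fun i _ _ => H.charge_nonneg i
      _ = ∑ i ∈ ((A.epochs σ).sigma (A.openedIn ω σ)).image Sigma.snd, c i := by
          congr 1
          ext i
          simp
      _ ≤ ∑ x ∈ (A.epochs σ).sigma (A.openedIn ω σ), c x.2 :=
          Finset.sum_image_le_of_nonneg fun i _ => H.charge_nonneg i
      _ = ∑ k ∈ A.epochs σ, ∑ i ∈ A.openedIn ω σ k, c i := Finset.sum_sigma _ _ _
  · exact (Finset.sum_fiberwise_of_maps_to hepoch _).ge

variable [NeZero m]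

lemma ccflCost_epochClients_le (H : ValidInput c u σ) (k : ℕ) (ω : Fin m → ℝ) :
    ccflCost c u σ (epochClients c u σ k) ((epochClients c u σ k).image (ccflTarget c u ω σ))
      (ccflTarget c u ω σ)
        ≤ epochZ c u σ k * (H.fractionalRun k).roundingBound (thresholdScale m n) ω := by
  have hZ := H.epochZ_pos k
  have hrounding := H.isRounding_ccflTarget k ω
  have hload (i : Fin m) :
      (∑ j ∈ epochClients c u σ k with ccflTarget c u ω σ j = i, (σ j).demand i) / u i
        ≤ epochZ c u σ k * (160 + 220 * Real.log (Fintype.card (Fin m))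
          + (H.fractionalRun k).missCount (thresholdScale m n) ω) := by
    rw [← div_le_iff₀' hZ, Finset.sum_div, Finset.sum_div]
    exact hrounding.sum_demand_le i
  have hcharge : ∑ i ∈ (epochClients c u σ k).image (ccflTarget c u ω σ), c i
      ≤ epochZ c u σ k * ((H.fractionalRun k).openCharge (thresholdScale m n) ω
        + (H.fractionalRun k).missCount (thresholdScale m n) ω) := by
    refine le_trans ?_ (mul_le_mul_of_nonneg_left (hrounding.sum_charge_le
      (zero_le_one.trans (one_le_thresholdScale m n))) hZ.le)
    rw [Finset.mul_sum]
    refine Finset.sum_le_sum fun i hi => le_mul_normalizedCharge hZ ?_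
    obtain ⟨j, hj, rfl⟩ := Finset.mem_image.1 hi
    exact H.charge_le_of_mem_affordable (hrounding.mem_allowed j hj)
  have hassign : ∑ j ∈ epochClients c u σ k, (σ j).assignCost (ccflTarget c u ω σ j)
      ≤ epochZ c u σ k * ((H.fractionalRun k).openAssignCost (thresholdScale m n) ω
        + (H.fractionalRun k).missCount (thresholdScale m n) ω) := by
    rw [← div_le_iff₀' hZ, Finset.sum_div]
    exact hrounding.sum_assignCost_le
  rw [ccflCost, FractionalRun.roundingBound]
  linarith [ciSup_le hload]

lemma ccflAlgorithm_epoch_cost_le (H : ValidInput c u σ) (k : ℕ) (ω : Fin m → ℝ) :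
    ccflCost c u σ ((ccflAlgorithm c u).served σ k) ((ccflAlgorithm c u).openedIn ω σ k)
      ((ccflAlgorithm c u).target ω σ)
        ≤ epochZ c u σ k * (H.fractionalRun k).roundingBound (thresholdScale m n) ω := by
  have hopened : (ccflAlgorithm c u).openedIn ω σ k
      = (epochClients c u σ k).image (ccflTarget c u ω σ) := Finset.biUnion_singleton
  rw [hopened]
  exact H.ccflCost_epochClients_le k ω

lemma sum_integral_roundingBound_le (H : ValidInput c u σ) :
    ∑ k ∈ (ccflAlgorithm c u).epochs σ, ∫ ω, epochZ c u σ k *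
      (H.fractionalRun k).roundingBound (thresholdScale m n) ω ∂thresholdMeasure (Fin m)
        ≤ 1024 * ((1 + Real.log m) * (1 + Real.log (m * n))) * ccflOpt c u σ := by
  have hbound (k : ℕ) : ∫ ω, epochZ c u σ k *
      (H.fractionalRun k).roundingBound (thresholdScale m n) ω ∂thresholdMeasure (Fin m)
        ≤ epochZ c u σ k * (256 * ((1 + Real.log m) * (1 + Real.log (m * n)))) := by
    rw [integral_const_mul]
    refine mul_le_mul_of_nonneg_left ?_ (H.epochZ_pos k).le
    exact (FractionalRun.integral_roundingBound_le (one_le_thresholdScale m n)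
      (mul_exp_neg_thresholdScale_le_one m n)).trans_eq (by rw [Fintype.card_fin, thresholdScale])
  have hratio : 0 ≤ 256 * ((1 + Real.log m) * (1 + Real.log (m * n))) := by
    have := zero_le_one.trans (one_le_thresholdScale m n)
    rw [thresholdScale] at this
    have := Real.log_natCast_nonneg m
    positivity
  refine (Finset.sum_le_sum fun k _ => hbound k).trans ?_
  rw [← Finset.sum_mul]
  linarith [mul_le_mul_of_nonneg_right H.sum_epochZ_le hratio]

theorem ccflEpochCost_le (H : ValidInput c u σ) :
    ccflEpochCost c u σ (ccflAlgorithm c u)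
      ≤ 1024 * ((1 + Real.log m) * (1 + Real.log (m * n))) * ccflOpt c u σ := by
  refine le_trans (Finset.sum_le_sum fun k _ => ?_) H.sum_integral_roundingBound_le
  exact integral_mono_of_nonneg (.of_forall fun ω => H.ccflCost_nonneg _ _ _)
    (FractionalRun.integrable_roundingBound.const_mul _)
    (.of_forall fun ω => H.ccflAlgorithm_epoch_cost_le k ω)

theorem ccflTotalCost_le (H : ValidInput c u σ) :
    ccflTotalCost c u σ (ccflAlgorithm c u)
      ≤ 1024 * ((1 + Real.log m) * (1 + Real.log (m * n))) * ccflOpt c u σ := by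
  have hint (k : ℕ) : Integrable (fun ω => epochZ c u σ k *
      (H.fractionalRun k).roundingBound (thresholdScale m n) ω) (thresholdMeasure (Fin m)) :=
    FractionalRun.integrable_roundingBound.const_mul _
  refine le_trans ?_ ((integral_finsetSum _ fun k _ => hint k).trans_le
    H.sum_integral_roundingBound_le)
  exact integral_mono_of_nonneg (.of_forall fun ω => H.ccflCost_nonneg _ _ _)
    (integrable_finsetSum _ fun k _ => hint k)
    (.of_forall fun ω => (H.ccflCost_opened_le_sum_epochs (ccflAlgorithm c u) ω).trans
      (Finset.sum_le_sum fun k _ => H.ccflAlgorithm_epoch_cost_le k ω))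

end ValidInput

/-- The guarantees for a run of `A` on the requests `σ`, where `w j i` is the cost of serving
request `j` alone by facility `i`: targets cost at most the current `Z`, which never exceeds twice
the optimum, and both the sum of the epoch costs and the total cost are at most `ratio` times the
optimum. -/
def EpochAlgorithm.IsCompetitive {R : Type} {m n : ℕ} (A : EpochAlgorithm R m n) (σ : Fin n → R)
    (w : Fin n → Fin m → ℝ) (opt epochCost totalCost ratio : ℝ) : Prop :=
  (∀ ω j, w j (A.target ω σ j) ≤ A.currentZ w σ j) ∧ (∀ j, A.currentZ w σ j ≤ 2 * opt) ∧
    epochCost ≤ ratio * opt ∧ totalCost ≤ ratio * opt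

theorem ValidInput.isCompetitive_ccflAlgorithm {m n : ℕ} [NeZero m] [NeZero n] {c u : Fin m → ℝ}
    {σ : Fin n → Client m} (H : ValidInput c u σ) :
    (ccflAlgorithm c u).IsCompetitive σ (ccflSingle c u σ) (ccflOpt c u σ)
      (ccflEpochCost c u σ (ccflAlgorithm c u)) (ccflTotalCost c u σ (ccflAlgorithm c u))
      (1024 * ((1 + Real.log m) * (1 + Real.log (m * n)))) :=
  ⟨fun ω j => mem_affordable.1 (H.ccflTarget_mem_affordable ω j), H.epochZ_ccflEpoch_le,
    H.ccflEpochCost_le, H.ccflTotalCost_le⟩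

section Jobs

variable {m n : ℕ}

/-- The algorithm that runs `A` on the translations under `g` of the requests. -/
def EpochAlgorithm.comap {R S : Type} (A : EpochAlgorithm R m n) (g : S → R) :
    EpochAlgorithm S m n where
  Ω := A.Ω
  μ := A.μ
  epoch σ := A.epoch (g ∘ σ)
  newOpen ω σ := A.newOpen ω (g ∘ σ)
  target ω σ := A.target ω (g ∘ σ)
  epoch_online _ _ _ h := A.epoch_online _ _ _ fun k hk => congrArg g (h k hk)
  newOpen_online _ _ _ _ h := A.newOpen_online _ _ _ _ fun k hk => congrArg g (h k hk)
  target_online _ _ _ _ h := A.target_online _ _ _ _ fun k hk => congrArg g (h k hk)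
  epoch_monotone _ := A.epoch_monotone _
  target_open _ _ := A.target_open _ _
  measurableSet_newOpen _ := A.measurableSet_newOpen _
  measurableSet_target _ := A.measurableSet_target _

/-- A job as a client without assignment costs. -/
def jobClient (p : Fin m → ℝ) : Client m where
  assignCost _ := 0
  demand := p

variable (c : Fin m → ℝ) (p : Fin n → Fin m → ℝ)

lemma umscSingle_eq_ccflSingle :
    umscSingle c p = ccflSingle c (fun _ => 1) (jobClient ∘ p) := by
  funext j i
  simp only [umscSingle, ccflSingle, jobClient, Function.comp_apply, div_one, add_zero]

lemma umscCost_eq_ccflCost (J : Finset (Fin n)) (O : Finset (Fin m)) (f : Fin n → Fin m) :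
    umscCost c p J O f = ccflCost c (fun _ => 1) (jobClient ∘ p) J O f := by
  simp only [umscCost, ccflCost, jobClient, Function.comp_apply, div_one, Finset.sum_const_zero,
    add_zero]

lemma umscOpt_eq_ccflOpt : umscOpt c p = ccflOpt c (fun _ => 1) (jobClient ∘ p) := by
  simp only [umscOpt, ccflOpt, umscCost_eq_ccflCost]

lemma umscEpochCost_comap (A : EpochAlgorithm (Client m) m n) :
    umscEpochCost c p (A.comap jobClient)
      = ccflEpochCost c (fun _ => 1) (jobClient ∘ p) A := by
  simp only [umscEpochCost, ccflEpochCost, umscCost_eq_ccflCost]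
  rfl

lemma umscTotalCost_comap (A : EpochAlgorithm (Client m) m n) :
    umscTotalCost c p (A.comap jobClient)
      = ccflTotalCost c (fun _ => 1) (jobClient ∘ p) A := by
  simp only [umscTotalCost, ccflTotalCost, umscCost_eq_ccflCost]
  rfl

end Jobs

section CostRatio

variable {m n : ℕ} [NeZero m] [NeZero n] {w : Fin n → Fin m → ℝ}

lemma one_le_costRatio (hw : ∀ j i, 0 < w j i) : 1 ≤ costRatio w := by
  refine le_trans ?_ (le_ciSup (Set.finite_range _).bddAbove 0)
  obtain ⟨i, hi⟩ := exists_eq_ciInf_of_finite (f := w 0)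
  rw [← hi, one_le_div (hw 0 i)]
  exact le_ciSup (Set.finite_range _).bddAbove i

lemma one_add_log_mul_one_add_log_le (hm : 2 ≤ m) (hn : 2 ≤ n) (hw : ∀ j i, 0 < w j i) :
    (1 + Real.log m) * (1 + Real.log (m * n))
      ≤ 4 * (Real.log (m * n) ^ 2 * Real.log (m * n * costRatio w)) := by
  have hm' : (2 : ℝ) ≤ m := by exact_mod_cast hm
  have hn' : (2 : ℝ) ≤ n := by exact_mod_cast hn
  have hlog_mn : 1 ≤ Real.log (m * n) := by
    rw [Real.le_log_iff_exp_le (by positivity)]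
    nlinarith [Real.exp_one_lt_d9]
  have hlog_m : Real.log m ≤ Real.log (m * n) :=
    Real.log_le_log (by positivity) (le_mul_of_one_le_right (by positivity) (by linarith))
  have hlog_ratio : 1 ≤ Real.log (m * n * costRatio w) := hlog_mn.trans <|
    Real.log_le_log (by positivity) (le_mul_of_one_le_right (by positivity) (one_le_costRatio hw))
  calc (1 + Real.log m) * (1 + Real.log (m * n))
      ≤ (2 * Real.log (m * n)) * (2 * Real.log (m * n)) := by gcongr <;> linarith
    _ = 4 * Real.log (m * n) ^ 2 := by ring
    _ ≤ 4 * (Real.log (m * n) ^ 2 * Real.log (m * n * costRatio w)) := by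
        gcongr
        exact le_mul_of_one_le_right (by positivity) hlog_ratio

lemma EpochAlgorithm.IsCompetitive.to_costRatio {R : Type} {A : EpochAlgorithm R m n}
    {σ : Fin n → R} {opt epochCost totalCost C : ℝ}
    (h : A.IsCompetitive σ w opt epochCost totalCost
      (C * ((1 + Real.log m) * (1 + Real.log (m * n)))))
    (hC : 0 ≤ C) (hm : 2 ≤ m) (hn : 2 ≤ n) (hw : ∀ j i, 0 < w j i) :
    A.IsCompetitive σ w opt epochCost totalCost
      (C * 4 * (Real.log (m * n) ^ 2 * Real.log (m * n * costRatio w))) := by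
  obtain ⟨htarget, hZ, hepoch, htotal⟩ := h
  have hopt : 0 ≤ opt := by
    have hpos : 0 ≤ A.currentZ w σ 0 :=
      mul_nonneg (by positivity) (Real.iInf_nonneg fun i => (hw _ i).le)
    linarith [hZ 0]
  have hratio : C * ((1 + Real.log m) * (1 + Real.log (m * n))) * opt
      ≤ C * 4 * (Real.log (m * n) ^ 2 * Real.log (m * n * costRatio w)) * opt := by
    rw [mul_assoc C 4]
    exact mul_le_mul_of_nonneg_right (mul_le_mul_of_nonneg_left
      (one_add_log_mul_one_add_log_le hm hn hw) hC) hopt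
  exact ⟨htarget, hZ, hepoch.trans hratio, htotal.trans hratio⟩

end CostRatio

theorem theorem8_general :
    ∃ C : ℝ, 0 < C ∧ ∀ m n : ℕ, ∀ [NeZero m] [NeZero n],
      (∀ c u : Fin m → ℝ, (∀ i, 0 ≤ c i) → (∀ i, 0 < u i) →
        ∃ A : EpochAlgorithm (Client m) m n, ∀ σ : Fin n → Client m,
          (∀ j i, 0 ≤ (σ j).demand i) → (∀ j i, 0 ≤ (σ j).assignCost i) →
          (∀ i, 0 < ccflSingle c u σ 0 i) →
          A.IsCompetitive σ (ccflSingle c u σ) (ccflOpt c u σ) (ccflEpochCost c u σ A)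
            (ccflTotalCost c u σ A) (C * ((1 + Real.log m) * (1 + Real.log (m * n))))) ∧
      (∀ c : Fin m → ℝ, (∀ i, 0 ≤ c i) →
        ∃ A : EpochAlgorithm (Fin m → ℝ) m n, ∀ p : Fin n → Fin m → ℝ,
          (∀ j i, 0 ≤ p j i) → (∀ i, 0 < umscSingle c p 0 i) →
          A.IsCompetitive p (umscSingle c p) (umscOpt c p) (umscEpochCost c p A)
            (umscTotalCost c p A) (C * ((1 + Real.log m) * (1 + Real.log (m * n))))) := by
  refine ⟨1024, by norm_num, fun m n _ _ => ⟨fun c u hc hu => ⟨ccflAlgorithm c u,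
    fun σ hd ha hw => ValidInput.isCompetitive_ccflAlgorithm ⟨hc, hu, hd, ha, hw⟩⟩,
    fun c hc => ⟨(ccflAlgorithm c fun _ => 1).comap jobClient, fun p hp hw => ?_⟩⟩⟩
  rw [umscEpochCost_comap, umscTotalCost_comap, umscOpt_eq_ccflOpt]
  rw [umscSingle_eq_ccflSingle] at hw ⊢
  exact ValidInput.isCompetitive_ccflAlgorithm ⟨hc, fun _ => one_pos, hp, fun _ _ => le_rfl, hw⟩

theorem theorem8 :
    ∃ C : ℝ, 0 < C ∧ ∀ m n : ℕ, 2 ≤ m → 2 ≤ n →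
      -- capacity-constrained facility location
      (∀ c u : Fin m → ℝ, (∀ i, 0 ≤ c i) → (∀ i, 0 < u i) →
        ∃ A : EpochAlgorithm (Client m) m n, ∀ σ : Fin n → Client m,
          (∀ j i, 0 ≤ (σ j).demand i) → (∀ j i, 0 ≤ (σ j).assignCost i) →
          (∀ j i, 0 < ccflSingle c u σ j i) →
          (∀ ω j, ccflSingle c u σ j (A.target ω σ j) ≤ A.currentZ (ccflSingle c u σ) σ j) ∧
          (∀ j, A.currentZ (ccflSingle c u σ) σ j ≤ 2 * ccflOpt c u σ) ∧
          ccflEpochCost c u σ A ≤ C * (Real.log (m * n) ^ 2 *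
            Real.log (m * n * costRatio (ccflSingle c u σ))) * ccflOpt c u σ ∧
          ccflTotalCost c u σ A ≤ C * (Real.log (m * n) ^ 2 *
            Real.log (m * n * costRatio (ccflSingle c u σ))) * ccflOpt c u σ) ∧
      -- unrelated machine scheduling with start-up costs
      (∀ c : Fin m → ℝ, (∀ i, 0 ≤ c i) →
        ∃ A : EpochAlgorithm (Fin m → ℝ) m n, ∀ p : Fin n → Fin m → ℝ,
          (∀ j i, 0 ≤ p j i) → (∀ j i, 0 < umscSingle c p j i) →
          (∀ ω j, umscSingle c p j (A.target ω p j) ≤ A.currentZ (umscSingle c p) p j) ∧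
          (∀ j, A.currentZ (umscSingle c p) p j ≤ 2 * umscOpt c p) ∧
          umscEpochCost c p A ≤ C * (Real.log (m * n) ^ 2 *
            Real.log (m * n * costRatio (umscSingle c p))) * umscOpt c p ∧
          umscTotalCost c p A ≤ C * (Real.log (m * n) ^ 2 *
            Real.log (m * n * costRatio (umscSingle c p))) * umscOpt c p) := by
  obtain ⟨C, hC, h⟩ := theorem8_general
  refine ⟨C * 4, by positivity, fun m n hm hn => ?_⟩
  have : NeZero m := ⟨by omega⟩
  have : NeZero n := ⟨by omega⟩
  obtain ⟨hccfl, humsc⟩ := h m n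
  exact ⟨fun c u hc hu => (hccfl c u hc hu).imp fun A hA σ hd ha hw =>
      (hA σ hd ha (hw 0)).to_costRatio hC.le hm hn hw,
    fun c hc => (humsc c hc).imp fun A hA p hp hw =>
      (hA p hp (hw 0)).to_costRatio hC.le hm hn hw⟩
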